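/- Let $0<\rho<1$, $0\le\pi<1$, and let $f_0,f_1$ be probability densities with respect to a common reference measure on a measurable space (for instance Lebesgue measure on $\mathbb R$) with finite Kullback–Leibler divergence $D(f_1\|f_0)<\infty$. Let $\Lambda$ be a random change-point with $P(\Lambda=0)=\pi$ and $P(\Lambda=\lambda)=(1-\pi)\rho(1-\rho)^{\lambda-1}$ for $\lambda=1,2,\dots$; given $\Lambda=\lambda$, the variables $X_1,X_2,\dots$ are independent, $X_k$ having density $f_0$ for $k<\lambda$ and $f_1$ for $k\ge\lambda$. An observer with $N$ sampling rights (never replenished) chooses $\mu_k\in\{0,1\}$ for $k\ge1$, where $\mu_k$ is a measurable function of $Z_1,\dots,Z_{k-1}$, with $Z_k=X_k$ if $\mu_k=1$ and $Z_k=\phi$ ("no observation") if $\mu_k=0$, and $\sum_{k\ge 1}\mu_k\le N$. She stops at a stopping time $\tau$ of the filtration $\mathcal F_k=\sigma(Z_1,\dots,Z_k,\{\Lambda=0\})$. Put $\mathrm{ADD}(\tau,\mu)=\mathbb E[(\tau-\Lambda)^+]$, $\mathrm{PFA}(\tau,\mu)=P(\tau<\Lambda)$, and let $\mathrm{ADD}^*(N,\alpha)$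 be the infimum of $\mathrm{ADD}(\tau,\mu)$ over all such pairs $(\tau,\mu)$ with $\mathrm{PFA}(\tau,\mu)\le\alpha$. Let $\varsigma\ge1$ be a fixed integer. Then there is a function $o(1)$ of $\alpha$, tending to $0$ as $\alpha\downarrow0$, such that for all sufficiently small $\alpha>0$ and every $N$ with $$N\ \ge\ \frac{|\log\alpha|}{|\log(1-\rho)|\,\varsigma}$$ one has $$\mathrm{ADD}^*(N,\alpha)\ \le\ \frac{\varsigma\,|\log\alpha|}{D(f_1\|f_0)+\varsigma\,|\log(1-\rho)|}\,(1+o(1)).$$ Moreover, this is achieved by uniform sampling with a threshold rule: sampling exactly at the times $\varsigma,2\varsigma,\dots,N\varsigma$ is admissible, and the rule $\tau=\inf\{n\varsigma:\ n\ge0,\ \pi_{n\varsigma}\ge1-\alpha\}$, where $\pi_k=P(\Lambda\le k\mid Z_1,\dots,Z_k)$, is a stopping time of the filtration $\sigma(Z_1,\dots,Z_k)$, satisfies $P(\tau<\Lambda)\le\alpha$, and its average detection delay is at most the same bound. -/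

import Mathlib

open MeasureTheory ProbabilityTheory InformationTheory Filter Topology
open scoped ENNReal

noncomputable section

namespace QuickestDetection

/-- `f` is a probability density with respect to the reference measure `m`. -/
structure IsPDF {E : Type*} [MeasurableSpace E] (m : Measure E) (f : E → ℝ≥0∞) : Prop where
  measurable : Measurable f
  lintegral_eq_one : ∫⁻ x, f x ∂m = 1

/-- The prior law of the change-point: mass `p` at `0` and mass
`(1 - p) ρ (1 - ρ) ^ (l - 1)` at `l = 1, 2, …`. -/
def prior (p ρ : ℝ) (l : ℕ) : ℝ :=
  if l = 0 then p else (1 - p) * ρ * (1 - ρ) ^ (l - 1)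

/-- The Bayesian change-point model.  `Λ` has the prior law and, given `Λ = l`, the variables
`X 1, X 2, …` are independent, `X k` having density `f₀` for `k < l` and `f₁` for `k ≥ l`.
(`X 0` plays no role.) -/
structure IsChangePointModel {Ω E : Type*} [MeasurableSpace Ω] [MeasurableSpace E]
    (P : Measure Ω) (m : Measure E) (f₀ f₁ : E → ℝ≥0∞) (p ρ : ℝ)
    (Λ : Ω → ℕ) (X : ℕ → Ω → E) : Prop where
  measurable_changePoint : Measurable Λ
  measurable_data : ∀ k, Measurable (X k)
  law_changePoint : ∀ l : ℕ, P (Λ ⁻¹' {l}) = ENNReal.ofReal (prior p ρ l)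
  indep_data : ∀ l : ℕ, P (Λ ⁻¹' {l}) ≠ 0 →
    iIndepFun (fun k : ℕ => X (k + 1)) (cond P (Λ ⁻¹' {l}))
  law_data : ∀ l : ℕ, P (Λ ⁻¹' {l}) ≠ 0 → ∀ k : ℕ, 1 ≤ k →
    (cond P (Λ ⁻¹' {l})).map (X k) = m.withDensity (if k < l then f₀ else f₁)

section Strategies

variable {Ω E : Type*} [MeasurableSpace E]

/-- The observation at slot `k` under the sampling decisions `μ`: the value `X k` when a sample is
taken, and the symbol "no observation" (`Sum.inr ()`) otherwise. -/
def obs (X : ℕ → Ω → E) (μ : ℕ → Ω → Bool) (k : ℕ) (ω : Ω) : E ⊕ Unit :=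
  if μ k ω = true then Sum.inl (X k ω) else Sum.inr ()

/-- `σ(Z_1, …, Z_k)`, the information carried by the observations up to slot `k`. -/
@[reducible] def obsSigma (X : ℕ → Ω → E) (μ : ℕ → Ω → Bool) (k : ℕ) : MeasurableSpace Ω :=
  ⨆ i ∈ Finset.Icc 1 k, MeasurableSpace.comap (obs X μ i) inferInstance

/-- `σ(Z_1, …, Z_k, {Λ = 0})`, the information on which the stopping decision at slot `k` may be
based. -/
@[reducible] def infoSigma (Λ : Ω → ℕ) (X : ℕ → Ω → E) (μ : ℕ → Ω → Bool) (k : ℕ) : MeasurableSpace Ω :=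
  obsSigma X μ k ⊔ MeasurableSpace.generateFrom {{ω | Λ ω = 0}}

/-- Number of sampling rights left at the end of slot `k`, starting from `N` rights and without
replenishment. -/
def rightsLeft (μ : ℕ → Ω → Bool) (N : ℕ) : ℕ → Ω → ℤ
  | 0, _ => N
  | k + 1, ω => rightsLeft μ N k ω - (if μ (k + 1) ω = true then 1 else 0)

/-- Admissible sampling strategies with `N` sampling rights: the decision at slot `k ≥ 1` is a
measurable function of the past observations `Z_1, …, Z_{k-1}` (which determine the past
decisions), and the number of rights left never becomes negative. -/
structure IsSamplingStrategy (X : ℕ → Ω → E) (N : ℕ) (μ : ℕ → Ω → Bool) : Prop where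
  causal : ∀ k : ℕ, Measurable[obsSigma X μ k] (μ (k + 1))
  rights_nonneg : ∀ (k : ℕ) (ω : Ω), 0 ≤ rightsLeft μ N k ω

/-- `τ` (with values in `ℕ ∪ {∞}`) is a stopping time with respect to the increasing family of
σ-algebras `𝓖`. -/
def IsStopTime (𝓖 : ℕ → MeasurableSpace Ω) (τ : Ω → ℕ∞) : Prop :=
  ∀ k : ℕ, MeasurableSet[𝓖 k] {ω | τ ω ≤ (k : ℕ∞)}

variable [MeasurableSpace Ω]

/-- Average detection delay `E[(τ - Λ)⁺]` (subtraction in `ℕ∞` is truncated at `0`). -/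
def ADD (P : Measure Ω) (Λ : Ω → ℕ) (τ : Ω → ℕ∞) : ℝ≥0∞ :=
  ∫⁻ ω, ((τ ω - (Λ ω : ℕ∞) : ℕ∞) : ℝ≥0∞) ∂P

/-- Probability of false alarm `P(τ < Λ)`. -/
def PFA (P : Measure Ω) (Λ : Ω → ℕ) (τ : Ω → ℕ∞) : ℝ≥0∞ :=
  P {ω | τ ω < (Λ ω : ℕ∞)}

/-- Optimal average detection delay with `N` sampling rights at false alarm level `α`: the infimum
of the delay over all admissible sampling strategies and all stopping times with false alarm
probability at most `α`. -/
def optimalADD (P : Measure Ω) (Λ : Ω → ℕ) (X : ℕ → Ω → E) (N : ℕ) (α : ℝ) : ℝ≥0∞ :=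
  ⨅ (μ : ℕ → Ω → Bool) (τ : Ω → ℕ∞) (_ : IsSamplingStrategy X N μ)
    (_ : IsStopTime (infoSigma Λ X μ) τ) (_ : PFA P Λ τ ≤ ENNReal.ofReal α), ADD P Λ τ

/-- Posterior probability `P(Λ ≤ k | Z_1, …, Z_k)` that the change has occurred by slot `k`; for
`k = 0` it is the prior probability `P(Λ = 0)`. -/
def posterior (P : Measure Ω) (Λ : Ω → ℕ) (X : ℕ → Ω → E) (μ : ℕ → Ω → Bool) (k : ℕ) : Ω → ℝ :=
  P[({ω | Λ ω ≤ k} : Set Ω).indicator (fun _ => (1 : ℝ)) | obsSigma X μ k]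

/-- Uniform sampling with period `s` and `N` rights: sample exactly at `s, 2s, …, Ns`. -/
def uniformStrategy (s N : ℕ) (k : ℕ) (_ : Ω) : Bool :=
  decide (s ∣ k ∧ k ≤ N * s)

/-- The threshold rule `inf {n s : posterior at time n s is at least 1 - α}` under uniform sampling
with period `s` and `N` rights (`inf ∅ = ∞`). -/
def thresholdRule (P : Measure Ω) (Λ : Ω → ℕ) (X : ℕ → Ω → E) (s N : ℕ) (α : ℝ) (ω : Ω) : ℕ∞ :=
  sInf {t : ℕ∞ | ∃ n : ℕ, t = ((n * s : ℕ) : ℕ∞) ∧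
    1 - α ≤ posterior P Λ X (uniformStrategy s N) (n * s) ω}

end Strategies

/-- The Kullback–Leibler divergence `D(f₁ ‖ f₀)` as an extended nonnegative number. -/
def divergence {E : Type*} [MeasurableSpace E] (m : Measure E) (f₁ f₀ : E → ℝ≥0∞) : ℝ≥0∞ :=
  klDiv (m.withDensity f₁) (m.withDensity f₀)

end QuickestDetection

end

open QuickestDetection

/-! The optimal delay is an infimum, so only uniform sampling with the threshold rule has to be
analysed. Write a = |log α|, d = s |log(1 - ρ)| and D for the divergence.

Fix Λ = l. By Bayes, the posterior probability of k < Λ is at most the prior ratio P(k < Λ) / P(Λ =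
l) divided by the likelihood ratio of the samples (`ae_likelihood_mul_le`). Each further period
costs the prior ratio a factor exp(-d), and each post-change sample adds log L to the
log-likelihood. While samples last, the rule has therefore stopped once a random walk with steps log
L + d, of drift D + d, passes a plus a constant (`ae_le_posterior_of_le_sum`). Wald's identity with
truncated steps bounds the mean passage by about a / (D + d) periods of length s
(`tsum_measure_staysBelow_le`).

If the walk has not crossed when the N rights are spent, the prior alone forces a stop within about
a / d more periods (`ae_le_posterior_of_exhausted`). Since N ≥ a / d, the walk has by then reached
about (D + d) a / d, which exceeds a by a fixed factor when D > 0; the strong law makes failure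
unlikely, and its cost is o(a) (`tendsto_crossingFailure`). If D = 0 the densities define the same
law, samples carry no information, and a pathwise bound from the prior suffices. -/

namespace QuickestDetection

/-! ### First passage of a random walk over a level -/

/-- The event that the partial sums of `Y` stay below the level `c` up to index `k`. -/
def staysBelow {Ω : Type*} (Y : ℕ → Ω → ℝ) (c : ℝ) (k : ℕ) : Set Ω :=
  {ω | ∀ t ≤ k, ∑ j ∈ Finset.range t, Y j ω < c}

lemma staysBelow_anti {Ω : Type*} (Y : ℕ → Ω → ℝ) (c : ℝ) : Antitone (staysBelow Y c) :=
  fun _ _ hab _ h t ht => h t (ht.trans hab)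

lemma measurableSet_staysBelow {Ω : Type*} [MeasurableSpace Ω] {Y : ℕ → Ω → ℝ}
    (hY : ∀ i, Measurable (Y i)) (c : ℝ) (k : ℕ) : MeasurableSet (staysBelow Y c k) := by
  have : staysBelow Y c k = ⋂ t ∈ Set.Iic k, {ω | ∑ j ∈ Finset.range t, Y j ω < c} := by
    ext ω; simp [staysBelow]
  rw [this]
  refine MeasurableSet.biInter (Set.to_countable _) fun t _ => ?_
  exact measurableSet_lt (Finset.measurable_sum _ fun i _ => hY i) measurable_const

/-- Truncated partial sums up to the first passage over `c` overshoot by at most the truncation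
level. -/
lemma sum_indicator_staysBelow_le {Ω : Type*} (Y : ℕ → Ω → ℝ) {c M : ℝ} (hc : 0 ≤ c)
    (hM : 0 ≤ M) (n : ℕ) (ω : Ω) :
    ∑ k ∈ Finset.range n, (staysBelow Y c k).indicator (fun _ => (1 : ℝ)) ω * min (Y k ω) M
      ≤ c + M := by
  induction n with
  | zero => simpa using add_nonneg hc hM
  | succ n ih =>
    rw [Finset.sum_range_succ]
    by_cases h : ω ∈ staysBelow Y c n
    · have h1 : ∀ k ∈ Finset.range n,
          (staysBelow Y c k).indicator (fun _ => (1 : ℝ)) ω * min (Y k ω) M ≤ Y k ω := by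
        intro k hk
        rw [Set.indicator_of_mem (staysBelow_anti Y c (Finset.mem_range.1 hk).le h), one_mul]
        exact min_le_left _ _
      have h2 := Finset.sum_le_sum h1
      have h3 := h n le_rfl
      rw [Set.indicator_of_mem h, one_mul]
      linarith [min_le_right (Y n ω) M]
    · rw [Set.indicator_of_notMem h]
      simpa using ih

/-- Wald's identity: staying below c up to index k depends only on the steps before k, hence is
independent of step k. Summing the products of expectations gives the mean of the stopped truncated
sum, which is at most c + M. -/
lemma sum_measureReal_staysBelow_mul_le {Ω : Type*} [MeasurableSpace Ω] {μ : Measure Ω}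
    [IsProbabilityMeasure μ] {Y : ℕ → Ω → ℝ} (hY : ∀ i, Measurable (Y i)) (hind : iIndepFun Y μ)
    {c M r : ℝ} (hc : 0 ≤ c) (hM : 0 ≤ M) (hint : ∀ i, Integrable (Y i) μ)
    (hmean : ∀ i, ∫ ω, min (Y i ω) M ∂μ = r) (n : ℕ) :
    (∑ k ∈ Finset.range n, μ.real (staysBelow Y c k)) * r ≤ c + M := by
  have hA : ∀ k, MeasurableSet (staysBelow Y c k) := measurableSet_staysBelow hY c
  have hmin : ∀ k, Integrable (fun ω => min (Y k ω) M) μ := fun k =>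
    (hint k).inf (integrable_const M)
  have hindep : ∀ k, IndepFun ((staysBelow Y c k).indicator fun _ => (1 : ℝ))
      (fun ω => min (Y k ω) M) μ := by
    intro k
    have h := hind.indepFun_finset (Finset.range k) {k} (by simp) hY
    -- The same event expressed in the coordinates below k only; the default 0 is never reached,
    -- since j < t ≤ k.
    let B : Set ((i : Finset.range k) → ℝ) :=
      {y | ∀ t ≤ k, ∑ j ∈ Finset.range t, (if h : j < k then y ⟨j, Finset.mem_range.2 h⟩ else 0) < c}
    have hB : MeasurableSet B := by
      have : B = ⋂ t ∈ Set.Iic k, {y | ∑ j ∈ Finset.range t,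
          (if h : j < k then y ⟨j, Finset.mem_range.2 h⟩ else 0) < c} := by
        ext y; simp [B]
      rw [this]
      refine MeasurableSet.biInter (Set.to_countable _) fun t _ => ?_
      refine measurableSet_lt (Finset.measurable_sum _ fun i _ => ?_) measurable_const
      split_ifs
      · exact measurable_pi_apply _
      · exact measurable_const
    have hψ : Measurable fun y : ({k} : Finset ℕ) → ℝ =>
        min (y ⟨k, Finset.mem_singleton_self k⟩) M := by fun_prop
    have h' := h.comp (_mγ := inferInstance) (_mγ' := inferInstance) (φ := B.indicator fun _ => (1 : ℝ))
      (ψ := fun y : ({k} : Finset ℕ) → ℝ => min (y ⟨k, Finset.mem_singleton_self k⟩) M)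
      (measurable_const.indicator hB) hψ
    suffices heq : (staysBelow Y c k).indicator (fun _ => (1 : ℝ))
        = (B.indicator fun _ => (1 : ℝ)) ∘ fun ω (i : Finset.range k) => Y i ω by
      rw [heq]
      exact h'
    ext ω
    have : ω ∈ staysBelow Y c k ↔ (fun i : Finset.range k => Y i ω) ∈ B := by
      refine forall_congr' fun t => forall_congr' fun ht => ?_
      rw [Finset.sum_congr rfl fun j hj => ?_]
      rw [dif_pos ((Finset.mem_range.1 hj).trans_le ht)]
    by_cases hω : ω ∈ staysBelow Y c k
    · simp [hω, this.1 hω]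
    · have := mt this.2 hω
      simp [hω, this]
  have hind1 : ∀ k, Integrable ((staysBelow Y c k).indicator fun _ => (1 : ℝ)) μ := fun k =>
    (integrable_const 1).indicator (hA k)
  have hprod : ∀ k, Integrable
      (fun ω => (staysBelow Y c k).indicator (fun _ => (1 : ℝ)) ω * min (Y k ω) M) μ := fun k =>
    (hindep k).integrable_mul (hind1 k) (hmin k)
  calc (∑ k ∈ Finset.range n, μ.real (staysBelow Y c k)) * r
      = ∑ k ∈ Finset.range n,
          ∫ ω, (staysBelow Y c k).indicator (fun _ => (1 : ℝ)) ω * min (Y k ω) M ∂μ := by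
        rw [Finset.sum_mul]
        refine Finset.sum_congr rfl fun k _ => ?_
        rw [(hindep k).integral_fun_mul_eq_mul_integral (hind1 k).aestronglyMeasurable
          (hmin k).aestronglyMeasurable, hmean k]
        simp [integral_indicator_const, hA k]
    _ = ∫ ω, ∑ k ∈ Finset.range n,
          (staysBelow Y c k).indicator (fun _ => (1 : ℝ)) ω * min (Y k ω) M ∂μ :=
        (integral_finsetSum _ fun k _ => hprod k).symm
    _ ≤ ∫ _, (c + M) ∂μ := integral_mono (integrable_finsetSum _ fun k _ => hprod k)
        (integrable_const _) fun ω => sum_indicator_staysBelow_le Y hc hM n ω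
    _ = c + M := by simp

/-- The expected first passage time over `c` of a random walk is at most `(c + M) / r`, where `r`
is the mean of the increments truncated from above at `M`. -/
lemma tsum_measure_staysBelow_le {Ω : Type*} [MeasurableSpace Ω] {μ : Measure Ω}
    [IsProbabilityMeasure μ] {Y : ℕ → Ω → ℝ} (hY : ∀ i, Measurable (Y i)) (hind : iIndepFun Y μ)
    {c M r : ℝ} (hc : 0 ≤ c) (hM : 0 ≤ M) (hr : 0 < r) (hint : ∀ i, Integrable (Y i) μ)
    (hmean : ∀ i, ∫ ω, min (Y i ω) M ∂μ = r) :
    ∑' k, μ (staysBelow Y c k) ≤ ENNReal.ofReal ((c + M) / r) := by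
  rw [ENNReal.tsum_eq_iSup_nat]
  refine iSup_le fun n => ?_
  have h := sum_measureReal_staysBelow_mul_le hY hind hc hM hint hmean n
  rw [← le_div_iff₀ hr] at h
  refine le_trans (le_of_eq ?_) (ENNReal.ofReal_le_ofReal h)
  rw [ENNReal.ofReal_sum_of_nonneg fun _ _ => measureReal_nonneg]
  simp [ofReal_measureReal]

/-- A random walk whose drift exceeds the asymptotic slope of a boundary is eventually above it. -/
lemma tendsto_measure_sum_lt {Ω ι : Type*} [MeasurableSpace Ω] {μ : Measure Ω}
    [IsProbabilityMeasure μ] {Y : ℕ → Ω → ℝ} (hY : ∀ i, Measurable (Y i)) (hind : iIndepFun Y μ)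
    (hint : Integrable (Y 0) μ) (hid : ∀ i, IdentDistrib (Y i) (Y 0) μ μ)
    {F : Filter ι} [F.IsCountablyGenerated] {n : ι → ℕ} {c : ι → ℝ} {v : ℝ}
    (hn : Tendsto n F atTop) (hc : Tendsto (fun i => c i / n i) F (𝓝 v))
    (hv : v < ∫ ω, Y 0 ω ∂μ) :
    Tendsto (fun i => μ {ω | ∑ j ∈ Finset.range (n i), Y j ω < c i}) F (𝓝 0) := by
  have hslln := strong_law_ae_real Y hint (fun i j hij => hind.indepFun hij) hid
  have h := tendsto_measure_of_ae_tendsto_indicator F (μ := μ) (A := (∅ : Set Ω))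
    (As := fun i => {ω | ∑ j ∈ Finset.range (n i), Y j ω < c i}) MeasurableSet.empty
    (fun i => measurableSet_lt (Finset.measurable_sum _ fun i _ => hY i) measurable_const)
    MeasurableSet.univ (measure_ne_top μ _) (Eventually.of_forall fun _ => Set.subset_univ _) ?_
  · simpa using h
  · filter_upwards [hslln] with ω hω
    have h1 := (hω.comp hn)
    filter_upwards [hc.eventually_lt h1 hv, hn.eventually_gt_atTop 0] with i hi hpos
    have hpos' : (0 : ℝ) < n i := by exact_mod_cast hpos
    simp only [Function.comp, Set.mem_empty_iff_false, iff_false, not_lt] at hi ⊢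
    exact ((div_lt_div_iff_of_pos_right hpos').1 hi).le

/-- Truncating from above at a high level hardly changes the mean. -/
lemma tendsto_integral_min {Ω : Type*} [MeasurableSpace Ω] {μ : Measure Ω} {Y : Ω → ℝ}
    (hint : Integrable Y μ) :
    Tendsto (fun M : ℕ => ∫ ω, min (Y ω) M ∂μ) atTop (𝓝 (∫ ω, Y ω ∂μ)) := by
  refine tendsto_integral_of_dominated_convergence (fun ω => |Y ω|) (fun n => ?_) hint.abs
    (fun n => ae_of_all _ fun ω => ?_) (ae_of_all _ fun ω => ?_)
  · exact hint.aestronglyMeasurable.inf aestronglyMeasurable_const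
  · rw [Real.norm_eq_abs]
    rcases le_total (Y ω) n with h | h
    · rw [min_eq_left h]
    · rw [min_eq_right h, abs_of_nonneg (Nat.cast_nonneg n)]
      exact h.trans (le_abs_self _)
  · refine tendsto_const_nhds.congr' ?_
    filter_upwards [eventually_ge_atTop ⌈Y ω⌉₊] with n hn
    rw [min_eq_left]
    exact (Nat.le_ceil _).trans (by exact_mod_cast hn)

/-! ### Conditional probabilities and product densities -/

/-- A conditional probability weighted by a measurable `h` is bounded by `c` as soon as its
integrals over all measurable events are. -/
lemma ae_mul_condExp_indicator_le {Ω : Type*} {m m0 : MeasurableSpace Ω} (hm : m ≤ m0)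
    {P : Measure Ω} [IsProbabilityMeasure P] {h : Ω → ℝ} (hh : Measurable[m] h)
    (hh0 : ∀ ω, 0 ≤ h ω) {U : Set Ω} (hU : MeasurableSet U) {c : ℝ} (hc : 0 ≤ c)
    (hle : ∀ G, MeasurableSet[m] G → ∫⁻ ω in G ∩ U, ENNReal.ofReal (h ω) ∂P
      ≤ ENNReal.ofReal c * P G) :
    ∀ᵐ ω ∂P, h ω * (P[U.indicator (fun _ => (1 : ℝ)) | m]) ω ≤ c := by
  have hhm : StronglyMeasurable[m] h := hh.stronglyMeasurable
  have hh' : Measurable h := hh.mono hm le_rfl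
  have hmul : h * U.indicator (fun _ => (1 : ℝ)) = U.indicator h := by
    ext ω; by_cases hω : ω ∈ U <;> simp [hω]
  have hintU : Integrable (U.indicator h) P := by
    rw [integrable_indicator_iff hU]
    refine ⟨hh'.aestronglyMeasurable, ?_⟩
    rw [hasFiniteIntegral_iff_ofReal (ae_of_all _ hh0)]
    have := hle Set.univ MeasurableSet.univ
    rw [Set.univ_inter] at this
    exact this.trans_lt (by simp)
  have hone : Integrable (U.indicator fun _ => (1 : ℝ)) P := (integrable_const 1).indicator hU
  have hpull := condExp_mul_of_stronglyMeasurable_left (μ := P) (m := m) hhm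
    (g := U.indicator fun _ => (1 : ℝ)) (by rwa [hmul]) hone
  rw [hmul] at hpull
  have hsm : StronglyMeasurable[m] (P[U.indicator h | m]) := stronglyMeasurable_condExp
  -- Comparing integrals over sets of `m` gives an almost sure bound for the measure trimmed to `m`,
  -- where both sides are measurable.
  have hbound : P[U.indicator h | m] ≤ᵐ[P.trim hm] fun _ => c := by
    refine ae_le_of_forall_setIntegral_le (integrable_condExp.trim hm hsm) (integrable_const c)
      fun G hG _ => ?_
    rw [← setIntegral_trim hm hsm hG, setIntegral_condExp hm hintU hG, setIntegral_const,
      setIntegral_indicator hU, integral_eq_lintegral_of_nonneg_ae (ae_of_all _ hh0)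
        hh'.aestronglyMeasurable, smul_eq_mul, measureReal_def, trim_measurableSet_eq hm hG]
    refine (ENNReal.toReal_mono (by finiteness) (hle G hG)).trans (le_of_eq ?_)
    rw [ENNReal.toReal_mul, ENNReal.toReal_ofReal hc, mul_comm]
  filter_upwards [ae_le_of_ae_le_trim hbound, hpull] with ω h1 h2
  rw [h2] at h1
  exact h1

lemma pi_withDensity {ι E : Type*} [Fintype ι] [MeasurableSpace E] (ν : ι → Measure E)
    [∀ i, IsProbabilityMeasure (ν i)] {g : ι → E → ℝ≥0∞} (hg : ∀ i, Measurable (g i))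
    [∀ i, SigmaFinite ((ν i).withDensity (g i))] :
    Measure.pi (fun i => (ν i).withDensity (g i))
      = (Measure.pi ν).withDensity fun x => ∏ i, g i (x i) := by
  refine Measure.pi_eq fun t ht => ?_
  rw [withDensity_apply _ (MeasurableSet.univ_pi ht), ← lintegral_indicator (MeasurableSet.univ_pi ht)]
  have h1 : (Set.univ.pi t).indicator (fun x => ∏ i, g i (x i))
      = fun x : ι → E => ∏ i, (t i).indicator (g i) (x i) := by
    ext x
    by_cases hx : x ∈ Set.univ.pi t
    · rw [Set.indicator_of_mem hx]
      exact Finset.prod_congr rfl fun i _ => (Set.indicator_of_mem (hx i trivial) _).symm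
    · rw [Set.indicator_of_notMem hx]
      simp only [Set.mem_pi, Set.mem_univ, true_imp_iff, not_forall] at hx
      obtain ⟨i, hi⟩ := hx
      exact (Finset.prod_eq_zero (Finset.mem_univ i) (Set.indicator_of_notMem hi _)).symm
  rw [h1]
  have hm : ∀ i, Measurable ((t i).indicator (g i)) := fun i => (hg i).indicator (ht i)
  rw [lintegral_prod_eq_prod_lintegral_of_indepFun Finset.univ
    (fun i (x : ι → E) => (t i).indicator (g i) (x i))
    (iIndepFun_pi fun i => (hm i).aemeasurable) fun i => (hm i).comp (measurable_pi_apply i)]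
  refine Finset.prod_congr rfl fun i _ => ?_
  rw [withDensity_apply _ (ht i), ← lintegral_indicator (ht i)]
  exact (measurePreserving_eval ν i).lintegral_comp (hm i)

lemma IsPDF.isProbabilityMeasure {E : Type*} [MeasurableSpace E] {m : Measure E} {f : E → ℝ≥0∞}
    (hf : IsPDF m f) : IsProbabilityMeasure (m.withDensity f) :=
  ⟨by rw [withDensity_apply _ MeasurableSet.univ, Measure.restrict_univ, hf.lintegral_eq_one]⟩

lemma measure_eq_tsum_inter_fiber {Ω : Type*} [MeasurableSpace Ω] (P : Measure Ω) {Λ : Ω → ℕ}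
    (hΛ : Measurable Λ) {S : Set Ω} (hS : MeasurableSet S) :
    P S = ∑' l : ℕ, P (S ∩ Λ ⁻¹' {l}) := by
  rw [← measure_iUnion]
  · congr 1
    ext ω
    simp
  · intro i j hij
    refine Set.disjoint_left.2 fun ω h1 h2 => hij ?_
    exact (h1.2 : Λ ω = i).symm.trans h2.2
  · exact fun l => hS.inter (hΛ (measurableSet_singleton l))

/-! ### Information carried by uniform sampling -/

/-- The first `n` samples taken under uniform sampling with period `s`. -/
def sampleVec {Ω E : Type*} (X : ℕ → Ω → E) (s n : ℕ) (ω : Ω) (j : Fin n) : E :=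
  X ((j + 1) * s) ω

section Filtration

variable {Ω E : Type*} [MeasurableSpace E]

lemma obsSigma_mono (X : ℕ → Ω → E) (μ : ℕ → Ω → Bool) : Monotone (obsSigma X μ) := by
  intro a b hab
  exact biSup_mono fun i hi => by
    rw [Finset.mem_Icc] at hi ⊢
    exact ⟨hi.1, hi.2.trans hab⟩

/-- The hypothesis says that no sample after the n-th is taken by slot k. It covers both k between
sampling times and k beyond N s, and lets every observable event be written as an event about a
finite vector. -/
lemma obsSigma_uniformStrategy_le_comap (X : ℕ → Ω → E) {s N k n : ℕ}
    (h : min k (N * s) ≤ n * s) :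
    obsSigma X (uniformStrategy s N) k
      ≤ MeasurableSpace.comap (sampleVec X s n) inferInstance := by
  refine iSup₂_le fun i hi => ?_
  rw [Finset.mem_Icc] at hi
  by_cases hsamp : s ∣ i ∧ i ≤ N * s
  · obtain ⟨⟨d, rfl⟩, hN⟩ := hsamp
    have hs : 0 < s := Nat.pos_of_mul_pos_right (by omega : 0 < s * d)
    have hd : 0 < d := Nat.pos_of_mul_pos_left (by omega : 0 < s * d)
    have hdn : d ≤ n := by
      have : s * d ≤ n * s := (le_min hi.2 hN).trans h
      rw [mul_comm n s] at this
      exact Nat.le_of_mul_le_mul_left this hs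
    have heq : obs X (uniformStrategy s N) (s * d)
        = (fun y : Fin n → E => (Sum.inl (y ⟨d - 1, by omega⟩) : E ⊕ Unit)) ∘ sampleVec X s n := by
      ext ω
      have : (d - 1 + 1) * s = s * d := by rw [Nat.sub_add_cancel hd, mul_comm]
      simp [obs, uniformStrategy, hN, sampleVec, this]
    rw [heq, ← MeasurableSpace.comap_comp]
    exact MeasurableSpace.comap_mono
      (measurable_inl.comp (measurable_pi_apply _)).comap_le
  · have heq : obs X (uniformStrategy s N) i = fun _ => Sum.inr () := by
      ext ω
      simp [obs, uniformStrategy, hsamp]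
    rw [heq, MeasurableSpace.comap_const]
    exact bot_le

lemma measurable_obsSigma_of_sampled (X : ℕ → Ω → E) {s N k i : ℕ} (hi : 1 ≤ i) (hik : i ≤ k)
    (hsi : s ∣ i) (hiN : i ≤ N * s) : Measurable[obsSigma X (uniformStrategy s N) k] (X i) := by
  intro A hA
  have h1 : X i ⁻¹' A = obs X (uniformStrategy s N) i ⁻¹' (Sum.inl '' A) := by
    ext ω
    simp [obs, uniformStrategy, hsi, hiN]
  rw [h1]
  have : MeasurableSpace.comap (obs X (uniformStrategy s N) i) inferInstance
      ≤ obsSigma X (uniformStrategy s N) k :=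
    le_iSup₂_of_le i (Finset.mem_Icc.2 ⟨hi, hik⟩) le_rfl
  exact this _ ⟨_, hA.inl_image, rfl⟩

lemma measurable_sampleVec [MeasurableSpace Ω] {X : ℕ → Ω → E} (hX : ∀ k, Measurable (X k))
    (s n : ℕ) : Measurable (sampleVec X s n) :=
  measurable_pi_lambda _ fun _ => hX _

lemma obsSigma_uniformStrategy_le [MeasurableSpace Ω] {X : ℕ → Ω → E}
    (hX : ∀ k, Measurable (X k)) (s N k : ℕ) :
    obsSigma X (uniformStrategy s N) k ≤ ‹MeasurableSpace Ω› :=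
  (obsSigma_uniformStrategy_le_comap X (n := N) (min_le_right _ _)).trans
    (measurable_sampleVec hX s N).comap_le

end Filtration

/-! ### Joint law of the samples and the change-point -/

section Model

variable {Ω E : Type*} [MeasurableSpace Ω] [MeasurableSpace E] {P : Measure Ω}
  {m : Measure E} {f₀ f₁ : E → ℝ≥0∞} {p ρ : ℝ} {Λ : Ω → ℕ}
  {X : ℕ → Ω → E}

lemma IsChangePointModel.measurableSet_fiber (h : IsChangePointModel P m f₀ f₁ p ρ Λ X) (l : ℕ) :
    MeasurableSet (Λ ⁻¹' {l}) :=
  h.measurable_changePoint (measurableSet_singleton l)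

lemma IsChangePointModel.measurableSet_lt (h : IsChangePointModel P m f₀ f₁ p ρ Λ X) (k : ℕ) :
    MeasurableSet {ω | k < Λ ω} :=
  h.measurable_changePoint measurableSet_Ioi

variable [IsProbabilityMeasure P]

lemma IsChangePointModel.measure_preimage_sampleVec_inter_fiber
    (h : IsChangePointModel P m f₀ f₁ p ρ Λ X) {s : ℕ} (hs : 1 ≤ s) (n l : ℕ)
    {B : Set (Fin n → E)} (hB : MeasurableSet B) :
    P (sampleVec X s n ⁻¹' B ∩ Λ ⁻¹' {l}) = P (Λ ⁻¹' {l}) *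
      Measure.pi (fun j : Fin n => m.withDensity (if (j + 1) * s < l then f₀ else f₁)) B := by
  by_cases hl : P (Λ ⁻¹' {l}) = 0
  · rw [hl, zero_mul]
    exact measure_mono_null Set.inter_subset_right hl
  have : IsProbabilityMeasure (cond P (Λ ⁻¹' {l})) := cond_isProbabilityMeasure hl
  -- The model indexes its independent family by k ↦ X (k + 1), hence the shift by one.
  have hinj : Function.Injective fun j : Fin n => (j + 1 : ℕ) * s - 1 := by
    intro i j hij
    have h1 : ∀ i : ℕ, 1 ≤ (i + 1) * s := fun i => Nat.mul_pos (Nat.succ_pos i) hs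
    have : ((i : ℕ) + 1) * s = (j + 1) * s := by
      have := h1 i; have := h1 j; simp only at hij; omega
    have := Nat.eq_of_mul_eq_mul_right hs this
    ext; omega
  have hX : ∀ j : Fin n, X ((j + 1) * s - 1 + 1) = X ((j + 1) * s) := fun j => by
    rw [Nat.sub_add_cancel (Nat.mul_pos (Nat.succ_pos _) hs)]
  have hind := (h.indep_data l hl).precomp hinj
  rw [iIndepFun_iff_map_fun_eq_pi_map fun j => (h.measurable_data _).aemeasurable] at hind
  simp only [hX] at hind
  have hlaw : ∀ j : Fin n, (cond P (Λ ⁻¹' {l})).map (X ((j + 1) * s))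
      = m.withDensity (if (j + 1) * s < l then f₀ else f₁) := fun j =>
    h.law_data l hl _ (Nat.mul_pos (Nat.succ_pos _) hs)
  simp only [hlaw] at hind
  rw [← hind]
  change _ = _ * (cond P (Λ ⁻¹' {l})).map (sampleVec X s n) B
  rw [Measure.map_apply (measurable_sampleVec h.measurable_data s n) hB,
    cond_apply (h.measurableSet_fiber l), ← mul_assoc,
    ENNReal.mul_inv_cancel hl (measure_ne_top P _), one_mul, Set.inter_comm]

/-- For each l > k ≥ n s all n samples precede the change, so their law does not depend on l and
factors out of the sum over l. -/
lemma IsChangePointModel.measure_preimage_sampleVec_inter_lt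
    (h : IsChangePointModel P m f₀ f₁ p ρ Λ X) {s : ℕ} (hs : 1 ≤ s) {n k : ℕ} (hk : n * s ≤ k)
    {B : Set (Fin n → E)} (hB : MeasurableSet B) :
    P (sampleVec X s n ⁻¹' B ∩ {ω | k < Λ ω}) = P {ω | k < Λ ω} *
      Measure.pi (fun _ : Fin n => m.withDensity f₀) B := by
  have hU := h.measurableSet_lt k
  rw [measure_eq_tsum_inter_fiber P h.measurable_changePoint
      ((measurable_sampleVec h.measurable_data s n hB).inter hU),
    measure_eq_tsum_inter_fiber P h.measurable_changePoint hU, ← ENNReal.tsum_mul_right]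
  refine tsum_congr fun l => ?_
  by_cases hl : k < l
  · have h1 : {ω | k < Λ ω} ∩ Λ ⁻¹' {l} = Λ ⁻¹' {l} := by
      refine Set.inter_eq_right.2 fun ω (hω : Λ ω = l) => ?_
      change k < Λ ω
      rwa [hω]
    rw [Set.inter_assoc, h1, h.measure_preimage_sampleVec_inter_fiber hs n l hB]
    congr 3
    ext j : 1
    have : ((j : ℕ) + 1) * s ≤ n * s := Nat.mul_le_mul_right s j.2
    rw [if_pos (by omega)]
  · have h1 : {ω | k < Λ ω} ∩ Λ ⁻¹' {l} = ∅ := by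
      ext ω
      simp only [Set.mem_inter_iff, Set.mem_empty_iff_false, iff_false]
      rintro ⟨h2, h3⟩
      exact hl ((h3 : Λ ω = l) ▸ h2)
    rw [Set.inter_assoc, h1]
    simp

/-- Change of measure: on k < Λ the samples are i.i.d. with density f₀, and weighting by L those
taken from l on turns their law into the one given Λ = l. This replaces an explicit Bayes formula
for the posterior. -/
lemma IsChangePointModel.lintegral_likelihood_inter_lt
    (h : IsChangePointModel P m f₀ f₁ p ρ Λ X) (hf₀ : IsPDF m f₀) (hf₁ : IsPDF m f₁)
    {L : E → ℝ≥0∞} (hL : Measurable L) (hQ : (m.withDensity f₀).withDensity L = m.withDensity f₁)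
    {s : ℕ} (hs : 1 ≤ s) {n k l : ℕ} (hk : n * s ≤ k) (hl : P (Λ ⁻¹' {l}) ≠ 0)
    {B : Set (Fin n → E)} (hB : MeasurableSet B) :
    ∫⁻ ω in sampleVec X s n ⁻¹' B ∩ {ω | k < Λ ω},
        ∏ j : Fin n, (if (j + 1) * s < l then 1 else L (X ((j + 1) * s) ω)) ∂P
      = P {ω | k < Λ ω} / P (Λ ⁻¹' {l}) * P (sampleVec X s n ⁻¹' B ∩ Λ ⁻¹' {l}) := by
  have := hf₀.isProbabilityMeasure
  have := hf₁.isProbabilityMeasure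
  have hU := h.measurableSet_lt k
  have hΦ := measurable_sampleVec h.measurable_data s n
  let g : Fin n → E → ℝ≥0∞ := fun j => if (j + 1) * s < l then 1 else L
  have hg : ∀ j, Measurable (g j) := fun j => by
    simp only [g]; split_ifs
    · exact measurable_one
    · exact hL
  have hgQ : ∀ j, (m.withDensity f₀).withDensity (g j)
      = m.withDensity (if (j + 1) * s < l then f₀ else f₁) := fun j => by
    simp only [g]; split_ifs
    · exact withDensity_one
    · exact hQ
  have : ∀ j, SigmaFinite ((m.withDensity f₀).withDensity (g j)) := fun j => by
    rw [hgQ]; split_ifs <;> infer_instance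
  have hmap : (P.restrict {ω | k < Λ ω}).map (sampleVec X s n)
      = P {ω | k < Λ ω} • Measure.pi (fun _ : Fin n => m.withDensity f₀) := by
    ext A hA
    rw [Measure.map_apply hΦ hA, Measure.restrict_apply (hΦ hA),
      h.measure_preimage_sampleVec_inter_lt hs hk hA, Measure.smul_apply, smul_eq_mul]
  have hGm : Measurable fun y : Fin n → E => ∏ j, g j (y j) :=
    Finset.measurable_prod _ fun j _ => (hg j).comp (measurable_pi_apply j)
  calc _ = ∫⁻ ω in sampleVec X s n ⁻¹' B, (fun y => ∏ j, g j (y j)) (sampleVec X s n ω)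
          ∂(P.restrict {ω | k < Λ ω}) := by
        rw [Measure.restrict_restrict (hΦ hB)]
        refine lintegral_congr fun ω => Finset.prod_congr rfl fun j _ => ?_
        simp only [g, sampleVec]
        split_ifs <;> rfl
    _ = P {ω | k < Λ ω} * Measure.pi (fun j => (m.withDensity f₀).withDensity (g j)) B := by
        rw [← setLIntegral_map hB hGm hΦ, hmap, Measure.restrict_smul, lintegral_smul_measure,
          ← withDensity_apply _ hB, pi_withDensity _ hg, smul_eq_mul]
    _ = _ := by
        rw [h.measure_preimage_sampleVec_inter_fiber hs n l hB, ← mul_assoc,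
          ENNReal.div_mul_cancel hl (measure_ne_top P _)]
        simp only [hgQ]

end Model

/-! ### Admissibility, stopping property and false alarms -/

lemma isSamplingStrategy_uniformStrategy {Ω E : Type*} [MeasurableSpace E] (X : ℕ → Ω → E)
    {s : ℕ} (hs : 1 ≤ s) (N : ℕ) : IsSamplingStrategy X N (uniformStrategy s N) where
  causal k := measurable_const
  rights_nonneg k ω := by
    have key : rightsLeft (uniformStrategy s N : ℕ → Ω → Bool) N k ω = N - min (k / s : ℕ) N := by
      induction k with
      | zero => simp [rightsLeft]
      | succ k ih =>
        rw [rightsLeft, ih, Nat.succ_div]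
        have h1 := Nat.div_mul_le_self k s
        have h2 : (uniformStrategy s N (k + 1) ω = true) ↔ s ∣ k + 1 ∧ k + 1 ≤ N * s := by
          simp [uniformStrategy]
        by_cases hd : s ∣ k + 1
        · have h3 : k + 1 = (k / s + 1) * s := by
            have := Nat.div_mul_cancel hd
            rwa [Nat.succ_div, if_pos hd, eq_comm] at this
          have h4 : k + 1 ≤ N * s ↔ k / s + 1 ≤ N := by
            rw [h3]
            exact ⟨fun h => Nat.le_of_mul_le_mul_right h hs, fun h => Nat.mul_le_mul_right s h⟩
          simp only [h2, hd, true_and, h4, if_true]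
          split_ifs <;> omega
        · simp [h2, hd]
    rw [key]
    omega

section Threshold

variable {Ω E : Type*} [MeasurableSpace Ω] [MeasurableSpace E] {P : Measure Ω} {Λ : Ω → ℕ}
  {X : ℕ → Ω → E} {s N : ℕ} {α : ℝ}

lemma thresholdRule_le {ω : Ω} {n : ℕ}
    (h : 1 - α ≤ posterior P Λ X (uniformStrategy s N) (n * s) ω) :
    thresholdRule P Λ X s N α ω ≤ ((n * s : ℕ) : ℕ∞) :=
  sInf_le ⟨n, rfl, h⟩

lemma exists_of_thresholdRule_ne_top {ω : Ω} (h : thresholdRule P Λ X s N α ω ≠ ⊤) :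
    ∃ n : ℕ, thresholdRule P Λ X s N α ω = ((n * s : ℕ) : ℕ∞) ∧
      1 - α ≤ posterior P Λ X (uniformStrategy s N) (n * s) ω := by
  have hne : {t : ℕ∞ | ∃ n : ℕ, t = ((n * s : ℕ) : ℕ∞) ∧
      1 - α ≤ posterior P Λ X (uniformStrategy s N) (n * s) ω}.Nonempty := by
    by_contra hemp
    rw [Set.not_nonempty_iff_eq_empty] at hemp
    exact h (by rw [thresholdRule, hemp, sInf_empty])
  exact csInf_mem hne

lemma measurableSet_le_posterior (P : Measure Ω) (Λ : Ω → ℕ) (X : ℕ → Ω → E) (s N k : ℕ)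
    (c : ℝ) : MeasurableSet[obsSigma X (uniformStrategy s N) k]
      {ω | c ≤ posterior P Λ X (uniformStrategy s N) k ω} := by
  have h : StronglyMeasurable[obsSigma X (uniformStrategy s N) k]
      (posterior P Λ X (uniformStrategy s N) k) := stronglyMeasurable_condExp
  exact h.measurable measurableSet_Ici

lemma isStopTime_thresholdRule (P : Measure Ω) (Λ : Ω → ℕ) (X : ℕ → Ω → E) (s N : ℕ) (α : ℝ) :
    IsStopTime (obsSigma X (uniformStrategy s N)) (thresholdRule P Λ X s N α) := by
  intro k
  have h : {ω | thresholdRule P Λ X s N α ω ≤ (k : ℕ∞)}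
      = ⋃ n ∈ {n : ℕ | n * s ≤ k},
        {ω | 1 - α ≤ posterior P Λ X (uniformStrategy s N) (n * s) ω} := by
    ext ω
    simp only [Set.mem_iUnion]
    constructor
    · intro hω
      obtain ⟨n, h1, h2⟩ := exists_of_thresholdRule_ne_top
        (ne_top_of_le_ne_top (ENat.natCast_ne_top k) hω)
      refine ⟨n, ?_, h2⟩
      have h3 : thresholdRule P Λ X s N α ω ≤ (k : ℕ∞) := hω
      rw [h1] at h3
      exact_mod_cast h3
    · rintro ⟨n, hn, h2⟩
      exact (thresholdRule_le h2).trans (by exact_mod_cast hn)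
  rw [h]
  refine MeasurableSet.biUnion (Set.to_countable _) fun n hn => ?_
  exact obsSigma_mono X _ hn _ (measurableSet_le_posterior P Λ X s N (n * s) (1 - α))

lemma posterior_ae_eq [IsProbabilityMeasure P] (hΛ : Measurable Λ) (hX : ∀ k, Measurable (X k))
    (s N k : ℕ) : ∀ᵐ ω ∂P, posterior P Λ X (uniformStrategy s N) k ω
      = 1 - (P[({ω | k < Λ ω} : Set Ω).indicator (fun _ => (1 : ℝ)) |
        obsSigma X (uniformStrategy s N) k]) ω := by
  have hU : MeasurableSet {ω | k < Λ ω} := hΛ measurableSet_Ioi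
  have h1 : ({ω | Λ ω ≤ k} : Set Ω).indicator (fun _ => (1 : ℝ))
      = (fun _ => (1 : ℝ)) - ({ω | k < Λ ω} : Set Ω).indicator (fun _ => (1 : ℝ)) := by
    ext ω
    by_cases hω : k < Λ ω
    · simp [hω]
    · simp [hω, not_lt.1 hω]
  have h2 := condExp_sub (m := obsSigma X (uniformStrategy s N) k) (integrable_const (1 : ℝ))
    ((integrable_const (1 : ℝ)).indicator (μ := P) hU)
  rw [condExp_const (obsSigma_uniformStrategy_le hX s N k)] at h2
  filter_upwards [h2] with ω hω
  rw [posterior, h1, hω]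
  rfl

lemma measure_inter_lt_le_of_posterior [IsProbabilityMeasure P] (hΛ : Measurable Λ)
    (hX : ∀ k, Measurable (X k)) {k : ℕ} (hα : 0 ≤ α) {G : Set Ω}
    (hG : MeasurableSet[obsSigma X (uniformStrategy s N) k] G)
    (hle : ∀ ω ∈ G, 1 - α ≤ posterior P Λ X (uniformStrategy s N) k ω) :
    P (G ∩ {ω | k < Λ ω}) ≤ ENNReal.ofReal α * P G := by
  have hm := obsSigma_uniformStrategy_le hX s N k
  have hU : MeasurableSet {ω | k < Λ ω} := hΛ measurableSet_Ioi
  have hint : Integrable (({ω | k < Λ ω} : Set Ω).indicator fun _ => (1 : ℝ)) P :=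
    (integrable_const 1).indicator hU
  have h1 := setIntegral_condExp hm hint hG
  rw [setIntegral_indicator hU, setIntegral_const, smul_eq_mul, mul_one] at h1
  have h2 : ∫ ω in G, (P[({ω | k < Λ ω} : Set Ω).indicator (fun _ => (1 : ℝ)) |
      obsSigma X (uniformStrategy s N) k]) ω ∂P ≤ ∫ _ in G, α ∂P := by
    refine setIntegral_mono_on_ae integrable_condExp.integrableOn
      (integrable_const α).integrableOn (hm _ hG) ?_
    filter_upwards [posterior_ae_eq hΛ hX s N k] with ω hω hωG
    have := hle ω hωG
    rw [hω] at this
    linarith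
  rw [h1, setIntegral_const, smul_eq_mul] at h2
  rw [← ofReal_measureReal (μ := P) (s := G), ← ENNReal.ofReal_mul hα, mul_comm,
    ← ofReal_measureReal (μ := P)]
  exact ENNReal.ofReal_le_ofReal h2

/-- At the stopping time the posterior probability of a change still to come is at most α. Splitting
by the first period at which the threshold is met and averaging gives the bound. -/
lemma pfa_thresholdRule_le [IsProbabilityMeasure P] (hΛ : Measurable Λ)
    (hX : ∀ k, Measurable (X k)) (hα : 0 ≤ α) :
    PFA P Λ (thresholdRule P Λ X s N α) ≤ ENNReal.ofReal α := by
  set G : ℕ → Set Ω := fun n =>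
    {ω | 1 - α ≤ posterior P Λ X (uniformStrategy s N) (n * s) ω} \
      ⋃ i ∈ Set.Iio n, {ω | 1 - α ≤ posterior P Λ X (uniformStrategy s N) (i * s) ω} with hGdef
  have hG : ∀ n, MeasurableSet[obsSigma X (uniformStrategy s N) (n * s)] (G n) := fun n =>
    (measurableSet_le_posterior P Λ X s N (n * s) (1 - α)).diff
      (MeasurableSet.biUnion (Set.to_countable _) fun i hi =>
        obsSigma_mono X _ (Nat.mul_le_mul_right s (le_of_lt hi)) _
          (measurableSet_le_posterior P Λ X s N (i * s) (1 - α)))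
  have hdisj : Pairwise (Function.onFun Disjoint G) := by
    refine (pairwise_disjoint_on G).2 fun i j hij => ?_
    exact Set.disjoint_left.2 fun ω hi hj => hj.2 (Set.mem_biUnion (x := i) hij hi.1)
  have hsub : {ω | thresholdRule P Λ X s N α ω < (Λ ω : ℕ∞)}
      ⊆ ⋃ n, G n ∩ {ω | n * s < Λ ω} := by
    intro ω hω
    have hω' : thresholdRule P Λ X s N α ω < (Λ ω : ℕ∞) := hω
    obtain ⟨n, h1, h2⟩ := exists_of_thresholdRule_ne_top (ne_top_of_lt hω')
    rw [h1] at hω'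
    have h3 : n * s < Λ ω := by exact_mod_cast hω'
    classical
    have hex : ∃ n, 1 - α ≤ posterior P Λ X (uniformStrategy s N) (n * s) ω := ⟨n, h2⟩
    refine Set.mem_iUnion.2 ⟨Nat.find hex, ⟨Nat.find_spec hex, ?_⟩, ?_⟩
    · intro hmem
      simp only [Set.mem_iUnion] at hmem
      obtain ⟨i, hi, h4⟩ := hmem
      exact Nat.find_min hex hi h4
    · exact (Nat.mul_le_mul_right s (Nat.find_min' hex h2)).trans_lt h3
  calc PFA P Λ (thresholdRule P Λ X s N α)
      ≤ ∑' n, P (G n ∩ {ω | n * s < Λ ω}) := (measure_mono hsub).trans (measure_iUnion_le _)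
    _ ≤ ∑' n, ENNReal.ofReal α * P (G n) := ENNReal.tsum_le_tsum fun n =>
        measure_inter_lt_le_of_posterior hΛ hX hα (hG n) fun ω hω => hω.1
    _ = ENNReal.ofReal α * P (⋃ n, G n) := by
        rw [ENNReal.tsum_mul_left, measure_iUnion hdisj fun n =>
          obsSigma_uniformStrategy_le hX s N _ _ (hG n)]
    _ ≤ ENNReal.ofReal α := mul_le_of_le_one_right' prob_le_one

end Threshold

/-! ### Posterior bounds and the log-likelihood walk -/

section Model

variable {Ω E : Type*} [MeasurableSpace Ω] [MeasurableSpace E] {P : Measure Ω}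
  [IsProbabilityMeasure P] {m : Measure E} {f₀ f₁ : E → ℝ≥0∞} {p ρ : ℝ} {Λ : Ω → ℕ}
  {X : ℕ → Ω → E}

lemma IsChangePointModel.measure_lt (h : IsChangePointModel P m f₀ f₁ p ρ Λ X) (hp₀ : 0 ≤ p)
    (hp₁ : p < 1) (hρ₀ : 0 < ρ) (hρ₁ : ρ < 1) (k : ℕ) :
    P {ω | k < Λ ω} = ENNReal.ofReal ((1 - p) * (1 - ρ) ^ k) := by
  have hcompl : {ω | 0 < Λ ω} = (Λ ⁻¹' {0})ᶜ := by
    ext ω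
    exact Nat.pos_iff_ne_zero
  have hnn : ∀ k, 0 ≤ (1 - p) * (1 - ρ) ^ k := fun k =>
    mul_nonneg (by linarith) (pow_nonneg (by linarith) k)
  induction k with
  | zero =>
    rw [hcompl, prob_compl_eq_one_sub (h.measurableSet_fiber 0), h.law_changePoint, prior,
      if_pos rfl, ← ENNReal.ofReal_one, ← ENNReal.ofReal_sub _ hp₀]
    simp
  | succ k ih =>
    have h1 : {ω | k < Λ ω} = {ω | k + 1 < Λ ω} ∪ Λ ⁻¹' {k + 1} := by
      ext ω
      change k < Λ ω ↔ k + 1 < Λ ω ∨ Λ ω = k + 1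
      omega
    have h2 : Disjoint {ω | k + 1 < Λ ω} (Λ ⁻¹' {k + 1}) := by
      refine Set.disjoint_left.2 fun ω (h3 : k + 1 < Λ ω) (h4 : Λ ω = k + 1) => ?_
      omega
    rw [h1, measure_union h2 (h.measurableSet_fiber _), h.law_changePoint, prior,
      if_neg (Nat.succ_ne_zero k), Nat.add_sub_cancel] at ih
    have h5 : (1 - p) * (1 - ρ) ^ k
        = (1 - p) * (1 - ρ) ^ (k + 1) + (1 - p) * ρ * (1 - ρ) ^ k := by ring
    rw [h5, ENNReal.ofReal_add (hnn _)
      (mul_nonneg (mul_nonneg (by linarith) hρ₀.le) (pow_nonneg (by linarith) k))] at ih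
    exact (ENNReal.add_left_inj ENNReal.ofReal_ne_top).1 ih

/-- The likelihood ratio of `Λ = l` against `k < Λ`, times the posterior probability of `k < Λ`, is
bounded by the ratio of the prior probabilities. -/
lemma IsChangePointModel.ae_likelihood_mul_le (h : IsChangePointModel P m f₀ f₁ p ρ Λ X)
    (hf₀ : IsPDF m f₀) (hf₁ : IsPDF m f₁) {L : E → ℝ≥0∞} (hL : Measurable L)
    (hQ : (m.withDensity f₀).withDensity L = m.withDensity f₁) {s N : ℕ} (hs : 1 ≤ s)
    {n k l : ℕ} (hk : n * s ≤ k) (hnN : n ≤ N) (hkn : min k (N * s) ≤ n * s)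
    (hl : P (Λ ⁻¹' {l}) ≠ 0) :
    ∀ᵐ ω ∂P, (∏ j : Fin n, (if (j + 1) * s < l then 1 else L (X ((j + 1) * s) ω))).toReal *
      (P[({ω | k < Λ ω} : Set Ω).indicator (fun _ => (1 : ℝ)) |
        obsSigma X (uniformStrategy s N) k]) ω ≤ (P {ω | k < Λ ω} / P (Λ ⁻¹' {l})).toReal := by
  have hmeas : Measurable[obsSigma X (uniformStrategy s N) k] fun ω =>
      ∏ j : Fin n, (if (j + 1) * s < l then 1 else L (X ((j + 1) * s) ω)) := by
    refine Finset.measurable_prod _ fun j _ => ?_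
    have h1 : ((j : ℕ) + 1) * s ≤ n * s := Nat.mul_le_mul_right s j.2
    split_ifs
    · exact measurable_const
    · exact hL.comp (measurable_obsSigma_of_sampled X (Nat.mul_pos (Nat.succ_pos _) hs)
        (h1.trans hk) (Dvd.intro_left _ rfl) (h1.trans (Nat.mul_le_mul_right s hnN)))
  have hfin : P {ω | k < Λ ω} / P (Λ ⁻¹' {l}) ≠ ∞ :=
    ENNReal.div_ne_top (measure_ne_top P _) hl
  refine ae_mul_condExp_indicator_le (obsSigma_uniformStrategy_le h.measurable_data s N k)
    hmeas.ennreal_toReal (fun ω => ENNReal.toReal_nonneg) (h.measurableSet_lt k)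
    ENNReal.toReal_nonneg fun G hG => ?_
  obtain ⟨B, hB, rfl⟩ := obsSigma_uniformStrategy_le_comap X hkn _ hG
  rw [ENNReal.ofReal_toReal hfin]
  refine (lintegral_mono fun ω => ENNReal.ofReal_toReal_le).trans ?_
  rw [h.lintegral_likelihood_inter_lt hf₀ hf₁ hL hQ hs hk hl hB]
  gcongr
  exact Set.inter_subset_left

/-- Once all sampling rights are used, the posterior weight of `k < Λ` decays geometrically. -/
lemma IsChangePointModel.ae_condExp_le_pow (h : IsChangePointModel P m f₀ f₁ p ρ Λ X)
    (hp₀ : 0 ≤ p) (hp₁ : p < 1) (hρ₀ : 0 < ρ) (hρ₁ : ρ < 1) {s : ℕ} (hs : 1 ≤ s) (N J : ℕ) :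
    ∀ᵐ ω ∂P, (P[({ω | (N + J) * s < Λ ω} : Set Ω).indicator (fun _ => (1 : ℝ)) |
        obsSigma X (uniformStrategy s N) ((N + J) * s)]) ω ≤ (1 - ρ) ^ (J * s) := by
  have hpow : 0 ≤ (1 - ρ) ^ (J * s) := pow_nonneg (by linarith) _
  have hle : N * s ≤ (N + J) * s := Nat.mul_le_mul_right s (Nat.le_add_right N J)
  have key := ae_mul_condExp_indicator_le (P := P)
    (obsSigma_uniformStrategy_le h.measurable_data s N ((N + J) * s)) (h := fun _ => 1)
    measurable_const (fun _ => zero_le_one) (h.measurableSet_lt ((N + J) * s)) hpow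
    fun G hG => by
      obtain ⟨B, hB, rfl⟩ := obsSigma_uniformStrategy_le_comap X (min_le_right _ _) _ hG
      rw [ENNReal.ofReal_one, setLIntegral_one,
        h.measure_preimage_sampleVec_inter_lt hs hle hB,
        -- Given N s < Λ, the N samples are independent of the excess of Λ over N s, whose tail is
        -- geometric.
        h.measure_lt hp₀ hp₁ hρ₀ hρ₁, add_mul, pow_add, ← mul_assoc, mul_comm _ ((1 - ρ) ^ (J * s)),
        ENNReal.ofReal_mul hpow, ← h.measure_lt hp₀ hp₁ hρ₀ hρ₁, mul_assoc,
        ← h.measure_preimage_sampleVec_inter_lt hs le_rfl hB]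
      gcongr
      exact Set.inter_subset_left
  filter_upwards [key] with ω hω
  simpa using hω

end Model

/-- The increments of the log-likelihood walk, with an extra drift `d`, over the samples taken
with period `s` from the change-point `l` on. -/
noncomputable def llrStep {Ω E : Type*} (L : E → ℝ≥0∞) (X : ℕ → Ω → E) (s : ℕ) (d : ℝ) (l j : ℕ)
    (ω : Ω) : ℝ :=
  Real.log (L (X (((l - 1) / s + 1 + j) * s) ω)).toReal + d

/-- The constant by which the detection boundary exceeds `|log α|`. -/
noncomputable def boundaryShift (p ρ : ℝ) (s : ℕ) : ℝ :=
  s * |Real.log (1 - ρ)| - Real.log ρ - Real.log p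

lemma boundaryShift_nonneg {p ρ : ℝ} (hp₀ : 0 ≤ p) (hp₁ : p < 1) (hρ₀ : 0 < ρ) (hρ₁ : ρ < 1)
    (s : ℕ) : 0 ≤ boundaryShift p ρ s := by
  have h1 := Real.log_nonpos hρ₀.le hρ₁.le
  have h2 := Real.log_nonpos hp₀ hp₁.le
  have h3 : 0 ≤ s * |Real.log (1 - ρ)| := by positivity
  unfold boundaryShift
  linarith

/-- Here (l - 1) / s counts the samples strictly before l. Truncated subtraction makes it 0 for l =
0 as well. -/
lemma div_mul_le_self_lt {s : ℕ} (hs : 1 ≤ s) (l : ℕ) :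
    (l - 1) / s * s ≤ l - 1 ∧ l ≤ (l - 1) / s * s + s := by
  have h1 := Nat.div_add_mod' (l - 1) s
  have h2 := Nat.mod_lt (l - 1) hs
  omega

/-- The three terms of `boundaryShift` absorb the rounding of l to the sampling grid, the factor ρ
of the prior when l ≥ 1, and the mass p when l = 0. If p = 0 the last term vanishes because
`Real.log 0 = 0`, and l = 0 is excluded by positivity. -/
lemma survival_le_exp_mul_prior {p ρ : ℝ} (hp₀ : 0 ≤ p) (hp₁ : p < 1) (hρ₀ : 0 < ρ) (hρ₁ : ρ < 1)
    {s : ℕ} (hs : 1 ≤ s) {l t : ℕ} (hl : 0 < prior p ρ l) :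
    (1 - p) * (1 - ρ) ^ (((l - 1) / s + t) * s)
      ≤ Real.exp (boundaryShift p ρ s - t * (s * |Real.log (1 - ρ)|)) * prior p ρ l := by
  have hb : Real.log (1 - ρ) = -|Real.log (1 - ρ)| := by
    rw [abs_of_nonpos (Real.log_nonpos (by linarith) (by linarith)), neg_neg]
  set b := |Real.log (1 - ρ)| with hbdef
  have hb0 : 0 ≤ b := abs_nonneg _
  have hpow : ∀ k : ℕ, (1 - ρ) ^ k = Real.exp (-(k * b)) := fun k => by
    rw [← Real.exp_log (show 0 < 1 - ρ by linarith), hb, ← Real.exp_nat_mul]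
    ring_nf
  have hlρ := Real.log_nonpos hρ₀.le hρ₁.le
  have hlp := Real.log_nonpos hp₀ hp₁.le
  have hsb : 0 ≤ s * b := by positivity
  rw [hpow]
  unfold boundaryShift prior at *
  split_ifs at hl ⊢ with h0
  · subst h0
    have h1 : p = Real.exp (Real.log p) := (Real.exp_log hl).symm
    calc (1 - p) * Real.exp (-(((((0 - 1) / s + t) * s : ℕ) : ℝ) * b))
        ≤ 1 * Real.exp (s * b - Real.log ρ - Real.log p - t * (s * b) + Real.log p) := by
          gcongr
          · linarith
          · simp only [zero_tsub, Nat.zero_div, zero_add, Nat.cast_mul]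
            linarith
      _ = _ := by rw [one_mul, Real.exp_add, Real.exp_log hl]
  · have h2 : (l : ℝ) ≤ ((l - 1) / s : ℕ) * s + s := by exact_mod_cast (div_mul_le_self_lt hs l).2
    have h3 : ((l - 1 : ℕ) : ℝ) = l - 1 := by
      rw [Nat.cast_sub (Nat.one_le_iff_ne_zero.2 h0), Nat.cast_one]
    rw [hpow, h3]
    generalize (l - 1) / s = q at h2 ⊢
    have h4 := mul_le_mul_of_nonneg_right h2 hb0
    calc (1 - p) * Real.exp (-((((q + t) * s : ℕ) : ℝ) * b))
        ≤ (1 - p) * Real.exp (s * b - Real.log ρ - Real.log p - t * (s * b) + Real.log ρ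
            + -((l - 1) * b)) := by
          refine mul_le_mul_of_nonneg_left (Real.exp_le_exp.2 ?_) (by linarith)
          push_cast
          linarith
      _ = _ := by
          rw [Real.exp_add, Real.exp_add, Real.exp_log hρ₀]
          ring

section Model

variable {Ω E : Type*} [MeasurableSpace Ω] [MeasurableSpace E] {P : Measure Ω}
  {m : Measure E} {f₀ f₁ : E → ℝ≥0∞} {p ρ : ℝ} {Λ : Ω → ℕ}
  {X : ℕ → Ω → E}

lemma IsChangePointModel.measurable_llrStep (h : IsChangePointModel P m f₀ f₁ p ρ Λ X)
    {L : E → ℝ≥0∞} (hL : Measurable L) (s : ℕ) (d : ℝ) (l j : ℕ) :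
    Measurable (llrStep L X s d l j) :=
  (hL.comp (h.measurable_data _)).ennreal_toReal.log.add_const d

lemma IsChangePointModel.iIndepFun_llrStep (h : IsChangePointModel P m f₀ f₁ p ρ Λ X)
    {L : E → ℝ≥0∞} (hL : Measurable L) {s : ℕ} (hs : 1 ≤ s) (d : ℝ) {l : ℕ}
    (hl : P (Λ ⁻¹' {l}) ≠ 0) : iIndepFun (llrStep L X s d l) (cond P (Λ ⁻¹' {l})) := by
  have h1 : ∀ j, 1 ≤ ((l - 1) / s + 1 + j) * s := fun j => Nat.mul_pos (Nat.add_pos_left (Nat.succ_pos _) _) hs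
  have hinj : Function.Injective fun j : ℕ => ((l - 1) / s + 1 + j) * s - 1 := by
    intro i j hij
    have : ((l - 1) / s + 1 + i) * s = ((l - 1) / s + 1 + j) * s := by
      have := h1 i; have := h1 j; simp only at hij; omega
    have := Nat.eq_of_mul_eq_mul_right hs this
    omega
  have hind := ((h.indep_data l hl).precomp hinj).comp (fun _ x => Real.log (L x).toReal + d)
    fun _ => (hL.ennreal_toReal.log).add_const d
  have hX : ∀ j, X (((l - 1) / s + 1 + j) * s - 1 + 1) = X (((l - 1) / s + 1 + j) * s) :=
    fun j => by rw [Nat.sub_add_cancel (h1 j)]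
  simp only [hX] at hind
  exact hind

lemma IsChangePointModel.measurePreserving_data (h : IsChangePointModel P m f₀ f₁ p ρ Λ X)
    {s : ℕ} (hs : 1 ≤ s) {l : ℕ} (hl : P (Λ ⁻¹' {l}) ≠ 0) (j : ℕ) :
    MeasurePreserving (X (((l - 1) / s + 1 + j) * s)) (cond P (Λ ⁻¹' {l}))
      (m.withDensity f₁) := by
  refine ⟨h.measurable_data _, ?_⟩
  rw [h.law_data l hl _ (Nat.mul_pos (Nat.add_pos_left (Nat.succ_pos _) _) hs), if_neg]
  rw [not_lt]
  calc l ≤ ((l - 1) / s + 1) * s := by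
        rw [add_mul, one_mul]; exact (div_mul_le_self_lt hs l).2
    _ ≤ _ := Nat.mul_le_mul_right s (Nat.le_add_right _ _)

variable [IsProbabilityMeasure P]

lemma IsChangePointModel.toReal_div_le (h : IsChangePointModel P m f₀ f₁ p ρ Λ X) (hp₀ : 0 ≤ p)
    (hp₁ : p < 1) (hρ₀ : 0 < ρ) (hρ₁ : ρ < 1) {s : ℕ} (hs : 1 ≤ s) {l : ℕ}
    (hl : P (Λ ⁻¹' {l}) ≠ 0) (t : ℕ) :
    (P {ω | ((l - 1) / s + t) * s < Λ ω} / P (Λ ⁻¹' {l})).toReal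
      ≤ Real.exp (boundaryShift p ρ s - t * (s * |Real.log (1 - ρ)|)) := by
  rw [h.law_changePoint] at hl ⊢
  have hl' : 0 < prior p ρ l := by simpa using hl
  rw [h.measure_lt hp₀ hp₁ hρ₀ hρ₁, ENNReal.toReal_div, ENNReal.toReal_ofReal hl'.le,
    ENNReal.toReal_ofReal (mul_nonneg (by linarith) (pow_nonneg (by linarith) _)),
    div_le_iff₀ hl']
  exact survival_le_exp_mul_prior hp₀ hp₁ hρ₀ hρ₁ hs hl'

lemma IsChangePointModel.ae_of_ae_density (h : IsChangePointModel P m f₀ f₁ p ρ Λ X) {l : ℕ}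
    (hl : P (Λ ⁻¹' {l}) ≠ 0) {i : ℕ} (hi : 1 ≤ i) (hil : l ≤ i) {q : E → Prop}
    (hq : ∀ᵐ x ∂(m.withDensity f₁), q x) : ∀ᵐ ω ∂P, Λ ω = l → q (X i ω) := by
  have hlaw := h.law_data l hl i hi
  rw [if_neg (not_lt.2 hil)] at hlaw
  rw [← hlaw] at hq
  have h1 := ae_of_ae_map (h.measurable_data i).aemeasurable hq
  rw [ProbabilityTheory.cond, Measure.ae_ennreal_smul_measure_iff
    (ENNReal.inv_ne_zero.2 (measure_ne_top P _)),
    ae_restrict_iff' (h.measurableSet_fiber l)] at h1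
  exact h1

/-- After the change, the posterior exceeds `1 - α` as soon as the log-likelihood walk exceeds
`|log α|` plus a constant, provided samples are still being taken. -/
lemma IsChangePointModel.ae_le_posterior_of_le_sum (h : IsChangePointModel P m f₀ f₁ p ρ Λ X)
    (hf₀ : IsPDF m f₀) (hf₁ : IsPDF m f₁) (hp₀ : 0 ≤ p)
    (hp₁ : p < 1) (hρ₀ : 0 < ρ) (hρ₁ : ρ < 1) {L : E → ℝ≥0∞} (hL : Measurable L)
    (hQ : (m.withDensity f₀).withDensity L = m.withDensity f₁)
    (hLpos : ∀ᵐ x ∂(m.withDensity f₁), 0 < L x ∧ L x < ∞) {s N : ℕ} (hs : 1 ≤ s) {l t : ℕ}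
    (hl : P (Λ ⁻¹' {l}) ≠ 0) (ht : (l - 1) / s + t ≤ N) {α : ℝ} (hα : 0 < α) :
    ∀ᵐ ω ∂P, Λ ω = l → -Real.log α + boundaryShift p ρ s
        ≤ ∑ j ∈ Finset.range t, llrStep L X s (s * |Real.log (1 - ρ)|) l j ω →
      1 - α ≤ posterior P Λ X (uniformStrategy s N) (((l - 1) / s + t) * s) ω := by
  obtain ⟨hq1, hq2⟩ := div_mul_le_self_lt hs l
  have hratio := h.toReal_div_le hp₀ hp₁ hρ₀ hρ₁ hs hl t
  have hbound := h.ae_likelihood_mul_le hf₀ hf₁ hL hQ hs (n := (l - 1) / s + t) le_rfl ht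
    (min_le_left _ _) hl
  have hpos : ∀ᵐ ω ∂P, ∀ j : ℕ, Λ ω = l →
      0 < L (X (((l - 1) / s + 1 + j) * s) ω) ∧ L (X (((l - 1) / s + 1 + j) * s) ω) < ∞ := by
    refine ae_all_iff.2 fun j => h.ae_of_ae_density hl ?_ ?_ hLpos
    · exact Nat.mul_pos (Nat.add_pos_left (Nat.succ_pos _) _) hs
    · calc l ≤ ((l - 1) / s + 1) * s := by rw [add_mul, one_mul]; exact hq2
        _ ≤ _ := Nat.mul_le_mul_right s (Nat.le_add_right _ _)
  filter_upwards [hbound, hpos, posterior_ae_eq h.measurable_changePoint h.measurable_data s N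
    (((l - 1) / s + t) * s)] with ω h1 h2 h3 hΛ hW
  set q := (l - 1) / s with hqdef
  -- The first q factors are 1, being pre-change; the other t are finite and positive, so their
  -- product is the exponential of the sum of logarithms.
  have hprod : (∏ j : Fin (q + t), (if ((j : ℕ) + 1) * s < l then 1
      else L (X ((j + 1) * s) ω))).toReal
      = Real.exp (∑ j ∈ Finset.range t, Real.log (L (X ((q + 1 + j) * s) ω)).toReal) := by
    rw [Fin.prod_univ_eq_prod_range
      (fun j => if (j + 1) * s < l then 1 else L (X ((j + 1) * s) ω)) (q + t),
      Finset.prod_range_add, Finset.prod_eq_one, one_mul, ENNReal.toReal_prod, Real.exp_sum]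
    · refine Finset.prod_congr rfl fun j _ => ?_
      have h4 : l ≤ (q + j + 1) * s := by
        calc l ≤ (q + 1) * s := by rw [add_mul, one_mul]; exact hq2
          _ ≤ _ := Nat.mul_le_mul_right s (by clear_value q; omega)
      rw [if_neg (not_lt.2 h4), show q + j + 1 = q + 1 + j by ring,
        Real.exp_log (ENNReal.toReal_pos (h2 j hΛ).1.ne' (h2 j hΛ).2.ne)]
    · intro j hj
      have h4 : (j + 1) * s ≤ q * s := Nat.mul_le_mul_right s (Finset.mem_range.1 hj)
      have h5 : 0 < (j + 1) * s := Nat.mul_pos (Nat.succ_pos _) hs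
      rw [if_pos (by clear_value q; omega)]
  rw [hprod] at h1
  rw [h3]
  simp only [llrStep, Finset.sum_add_distrib, Finset.sum_const, Finset.card_range,
    nsmul_eq_mul] at hW
  set S := ∑ j ∈ Finset.range t, Real.log (L (X ((q + 1 + j) * s) ω)).toReal
  have h6 : Real.exp (boundaryShift p ρ s - t * (s * |Real.log (1 - ρ)|)) ≤ Real.exp S * α := by
    rw [← Real.exp_log hα, ← Real.exp_add]
    exact Real.exp_le_exp.2 (by linarith)
  have h7 := le_of_mul_le_mul_left ((h1.trans hratio).trans h6) (Real.exp_pos S)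
  linarith

/-- If the two densities agree, the posterior is governed by the prior alone. -/
lemma IsChangePointModel.ae_le_posterior_of_eq (h : IsChangePointModel P m f₀ f₁ p ρ Λ X)
    (hf₀ : IsPDF m f₀) (hf₁ : IsPDF m f₁) (hp₀ : 0 ≤ p)
    (hp₁ : p < 1) (hρ₀ : 0 < ρ) (hρ₁ : ρ < 1) (heq : m.withDensity f₁ = m.withDensity f₀)
    {s : ℕ} (N : ℕ) (hs : 1 ≤ s) {l t : ℕ} (hl : P (Λ ⁻¹' {l}) ≠ 0) {α : ℝ} (hα : 0 < α)
    (ht : -Real.log α + boundaryShift p ρ s ≤ t * (s * |Real.log (1 - ρ)|)) :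
    ∀ᵐ ω ∂P, 1 - α ≤ posterior P Λ X (uniformStrategy s N) (((l - 1) / s + t) * s) ω := by
  have hratio := h.toReal_div_le hp₀ hp₁ hρ₀ hρ₁ hs hl t
  have hmin : min ((l - 1) / s + t) N * s = min (((l - 1) / s + t) * s) (N * s) := by
    rcases le_total ((l - 1) / s + t) N with h' | h'
    · rw [min_eq_left h', min_eq_left (Nat.mul_le_mul_right s h')]
    · rw [min_eq_right h', min_eq_right (Nat.mul_le_mul_right s h')]
  -- With equal laws the likelihood ratio is 1. The minimum with N counts the samples available when
  -- the rights may already be spent.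
  have hbound := h.ae_likelihood_mul_le hf₀ hf₁ (L := 1) measurable_one
    (by rw [withDensity_one, heq]) hs (n := min ((l - 1) / s + t) N)
    (Nat.mul_le_mul_right s (min_le_left _ _)) (min_le_right _ _) hmin.ge hl
  filter_upwards [hbound, posterior_ae_eq h.measurable_changePoint h.measurable_data s N
    (((l - 1) / s + t) * s)] with ω h1 h3
  rw [h3]
  simp only [Pi.one_apply, ite_self, Finset.prod_const_one, ENNReal.toReal_one, one_mul] at h1
  have h6 : Real.exp (boundaryShift p ρ s - t * (s * |Real.log (1 - ρ)|)) ≤ α := by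
    rw [← Real.exp_log hα]
    exact Real.exp_le_exp.2 (by linarith [Real.exp_log hα])
  linarith

lemma IsChangePointModel.ae_le_posterior_of_exhausted (h : IsChangePointModel P m f₀ f₁ p ρ Λ X)
    (hp₀ : 0 ≤ p) (hp₁ : p < 1) (hρ₀ : 0 < ρ) (hρ₁ : ρ < 1) {s : ℕ} (hs : 1 ≤ s) (N : ℕ) {J : ℕ}
    {α : ℝ} (hα : 0 < α) (hJ : -Real.log α ≤ J * (s * |Real.log (1 - ρ)|)) :
    ∀ᵐ ω ∂P, 1 - α ≤ posterior P Λ X (uniformStrategy s N) ((N + J) * s) ω := by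
  filter_upwards [h.ae_condExp_le_pow hp₀ hp₁ hρ₀ hρ₁ hs N J,
    posterior_ae_eq h.measurable_changePoint h.measurable_data s N ((N + J) * s)] with ω h1 h3
  rw [h3]
  have h2 : (1 - ρ) ^ (J * s) ≤ α := by
    rw [abs_of_nonpos (Real.log_nonpos (by linarith) (by linarith))] at hJ
    rw [← Real.log_le_log_iff (pow_pos (by linarith) _) hα, Real.log_pow]
    push_cast
    linarith
  linarith

end Model

/-! ### From first passage to average detection delay -/

lemma natCast_le_tsum_indicator_staysBelow {Ω : Type*} {Y : ℕ → Ω → ℝ} {c : ℝ} {t : ℕ} {ω : Ω}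
    (h : ∀ k < t, ω ∈ staysBelow Y c k) :
    (t : ℝ≥0∞) ≤ ∑' k, (staysBelow Y c k).indicator (fun _ => (1 : ℝ≥0∞)) ω := by
  refine le_trans (le_of_eq ?_) (ENNReal.sum_le_tsum (Finset.range t))
  rw [Finset.sum_congr rfl fun k hk => Set.indicator_of_mem (h k (Finset.mem_range.1 hk)) _]
  simp

/-- Pathwise bound on the detection delay in terms of the first passage of a walk `Y`, when
crossing the level `c` forces a stop during the first `N` periods and `J` further periods always
suffice. -/
lemma delay_le_of_staysBelow {Ω : Type*} {Y : ℕ → Ω → ℝ} {c : ℝ} (hc : 0 < c) {s N J l : ℕ}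
    (hs : 1 ≤ s) {ω : Ω} {T : ℕ∞}
    (hhit : ∀ t : ℕ, (l - 1) / s + t ≤ N → c ≤ ∑ j ∈ Finset.range t, Y j ω →
      T ≤ ((((l - 1) / s + t) * s : ℕ) : ℕ∞))
    (hend : T ≤ (((N + J) * s : ℕ) : ℕ∞)) :
    ((T - (l : ℕ∞) : ℕ∞) : ℝ≥0∞)
      ≤ s * ∑' k, (staysBelow Y c k).indicator (fun _ => (1 : ℝ≥0∞)) ω
        + (J * s : ℕ) *
          (staysBelow Y c (N - (l - 1) / s)).indicator (fun _ => (1 : ℝ≥0∞)) ω := by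
  obtain ⟨hq1, -⟩ := div_mul_le_self_lt hs l
  generalize (l - 1) / s = q at *
  have hcast : ∀ {a b : ℕ}, T ≤ (a : ℕ∞) → a ≤ b + l →
      ((T - (l : ℕ∞) : ℕ∞) : ℝ≥0∞) ≤ (b : ℝ≥0∞) := by
    intro a b ha hb
    have : T - (l : ℕ∞) ≤ (b : ℕ∞) := tsub_le_iff_right.2 (ha.trans (by exact_mod_cast hb))
    exact_mod_cast ENat.toENNReal_le.2 this
  by_cases hex : ∃ t, t ≤ N - q ∧ c ≤ ∑ j ∈ Finset.range t, Y j ω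
  · classical
    have hspec := Nat.find_spec hex
    have hmin : ∀ k < Nat.find hex, ω ∈ staysBelow Y c k := by
      intro k hk t ht
      by_contra hcon
      exact Nat.find_min hex (ht.trans_lt hk)
        ⟨(ht.trans hk.le).trans hspec.1, not_lt.1 hcon⟩
    generalize Nat.find hex = t at hspec hmin
    -- Truncated subtraction makes t ≤ N - q true for t = 0 even when q > N. Since c > 0, crossing
    -- needs t ≥ 1, which gives q + t ≤ N.
    have ht0 : t ≠ 0 := by
      rintro rfl
      have h0 := hspec.2
      rw [Finset.sum_range_zero] at h0
      linarith
    have h1 := hcast (b := s * t) (hhit t (by omega) hspec.2) (by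
      rw [add_mul, mul_comm t s]
      omega)
    refine (h1.trans ?_).trans le_self_add
    rw [Nat.cast_mul]
    gcongr
    exact natCast_le_tsum_indicator_staysBelow hmin
  · push Not at hex
    have hmem : ω ∈ staysBelow Y c (N - q) := fun t ht => hex t ht
    have hle : (N - q : ℕ) ≤ ∑' k, (staysBelow Y c k).indicator (fun _ => (1 : ℝ≥0∞)) ω :=
      natCast_le_tsum_indicator_staysBelow fun k hk => staysBelow_anti Y c hk.le hmem
    have h1 := hcast (b := s * (N - q) + J * s) hend (by
      have h2 : N * s ≤ (N - q) * s + q * s := by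
        rw [← add_mul]
        exact Nat.mul_le_mul_right s (by omega)
      rw [add_mul, mul_comm s]
      omega)
    rw [Set.indicator_of_mem hmem, mul_one]
    refine h1.trans ?_
    rw [Nat.cast_add, Nat.cast_mul]
    gcongr

section Model

variable {Ω E : Type*} [MeasurableSpace Ω] [MeasurableSpace E] {P : Measure Ω}
  {m : Measure E} {f₀ f₁ : E → ℝ≥0∞} {p ρ : ℝ} {Λ : Ω → ℕ}
  {X : ℕ → Ω → E}

lemma IsChangePointModel.add_eq_tsum (h : IsChangePointModel P m f₀ f₁ p ρ Λ X) (T : Ω → ℕ∞) :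
    ADD P Λ T = ∑' l : ℕ, ∫⁻ ω in Λ ⁻¹' {l}, ((T ω - (l : ℕ∞) : ℕ∞) : ℝ≥0∞) ∂P := by
  have huniv : (Set.univ : Set Ω) = ⋃ l : ℕ, Λ ⁻¹' {l} := by
    ext ω
    simp
  rw [ADD, ← setLIntegral_univ, huniv, lintegral_iUnion h.measurableSet_fiber]
  · refine tsum_congr fun l => setLIntegral_congr_fun (h.measurableSet_fiber l) fun ω hω => ?_
    rw [show Λ ω = l from hω]
  · intro i j hij
    exact Set.disjoint_left.2 fun ω h1 h2 => hij ((h1 : Λ ω = i).symm.trans h2)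

variable [IsProbabilityMeasure P]

lemma IsChangePointModel.tsum_measure_fiber (h : IsChangePointModel P m f₀ f₁ p ρ Λ X) :
    ∑' l : ℕ, P (Λ ⁻¹' {l}) = 1 := by
  have := measure_eq_tsum_inter_fiber P h.measurable_changePoint MeasurableSet.univ
  simpa using this.symm

/-- Probability that the walk started at the change-point is still below `c` after the sample
number `n`. -/
noncomputable def crossingFailure (P : Measure Ω) (Λ : Ω → ℕ) (X : ℕ → Ω → E) (L : E → ℝ≥0∞)
    (s : ℕ) (d : ℝ) (n : ℕ) (c : ℝ) : ℝ≥0∞ :=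
  ∑' l : ℕ, P (Λ ⁻¹' {l} ∩
    {ω | ∑ j ∈ Finset.range (n - (l - 1) / s), llrStep L X s d l j ω < c})

/-- The pathwise delay bound is integrated on each event Λ = l and summed over l. The index n ≤ N
keeps the right side independent of N, so the final estimate is uniform in N. -/
lemma IsChangePointModel.add_thresholdRule_le (h : IsChangePointModel P m f₀ f₁ p ρ Λ X)
    (hf₀ : IsPDF m f₀) (hf₁ : IsPDF m f₁) (hp₀ : 0 ≤ p)
    (hp₁ : p < 1) (hρ₀ : 0 < ρ) (hρ₁ : ρ < 1) {L : E → ℝ≥0∞} (hL : Measurable L)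
    (hQ : (m.withDensity f₀).withDensity L = m.withDensity f₁)
    (hLpos : ∀ᵐ x ∂(m.withDensity f₁), 0 < L x ∧ L x < ∞) {s : ℕ} (hs : 1 ≤ s) {d : ℝ}
    (hd : d = s * |Real.log (1 - ρ)|)
    (hint : Integrable (fun x => Real.log (L x).toReal) (m.withDensity f₁))
    {M r : ℝ} (hM : 0 ≤ M) (hr : 0 < r)
    (hmean : ∫ x, min (Real.log (L x).toReal + d) M ∂(m.withDensity f₁) = r)
    {α : ℝ} (hα : 0 < α) (hα1 : α < 1) {n N J : ℕ} (hnN : n ≤ N) (hJ : -Real.log α ≤ J * d) :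
    ADD P Λ (thresholdRule P Λ X s N α)
      ≤ s * ENNReal.ofReal ((-Real.log α + boundaryShift p ρ s + M) / r)
        + (J * s : ℕ) *
          crossingFailure P Λ X L s d n (-Real.log α + boundaryShift p ρ s) := by
  have := hf₁.isProbabilityMeasure
  set c := -Real.log α + boundaryShift p ρ s with hcdef
  have hc : 0 < c := by
    have := boundaryShift_nonneg hp₀ hp₁ hρ₀ hρ₁ s
    have := Real.log_neg hα hα1
    linarith
  set K := ENNReal.ofReal ((c + M) / r)
  have hl : ∀ l : ℕ, ∫⁻ ω in Λ ⁻¹' {l},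
      ((thresholdRule P Λ X s N α ω - (l : ℕ∞) : ℕ∞) : ℝ≥0∞) ∂P
      ≤ P (Λ ⁻¹' {l}) * (s * K) + (J * s : ℕ) * P (Λ ⁻¹' {l} ∩
        {ω | ∑ j ∈ Finset.range (n - (l - 1) / s), llrStep L X s d l j ω < c}) := by
    intro l
    by_cases hl : P (Λ ⁻¹' {l}) = 0
    · rw [setLIntegral_measure_zero _ _ hl]
      exact zero_le
    set ν := ProbabilityTheory.cond P (Λ ⁻¹' {l}) with hν
    have : IsProbabilityMeasure ν := cond_isProbabilityMeasure hl
    have hres : P.restrict (Λ ⁻¹' {l}) = P (Λ ⁻¹' {l}) • ν := by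
      rw [hν, ProbabilityTheory.cond, smul_smul, ENNReal.mul_inv_cancel hl (measure_ne_top P _),
        one_smul]
    set A := staysBelow (llrStep L X s d l) c with hA
    have hAm : ∀ k, MeasurableSet (A k) :=
      measurableSet_staysBelow (h.measurable_llrStep hL s d l) c
    have hmp := h.measurePreserving_data hs hl
    have hT : ∑' k, ν (A k) ≤ K := by
      have hint' : Integrable (fun x => Real.log (L x).toReal + d) (m.withDensity f₁) :=
        hint.add (integrable_const d)
      refine tsum_measure_staysBelow_le (h.measurable_llrStep hL s d l)
        (h.iIndepFun_llrStep hL hs d hl) hc.le hM hr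
        (fun j => (hmp j).integrable_comp_of_integrable hint') fun j => ?_
      rw [← hmean, ← (hmp j).map_eq,
        integral_map (h.measurable_data _).aemeasurable]
      · rfl
      · exact ((hL.ennreal_toReal.log.add_const d).min measurable_const).aestronglyMeasurable
    have hpath : ∀ᵐ ω ∂P, ω ∈ Λ ⁻¹' {l} →
        ((thresholdRule P Λ X s N α ω - (l : ℕ∞) : ℕ∞) : ℝ≥0∞)
        ≤ s * ∑' k, (A k).indicator (fun _ => (1 : ℝ≥0∞)) ω
          + (J * s : ℕ) * (A (N - (l - 1) / s)).indicator (fun _ => (1 : ℝ≥0∞)) ω := by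
      have h1 : ∀ᵐ ω ∂P, ∀ t : ℕ, (l - 1) / s + t ≤ N → Λ ω = l →
          c ≤ ∑ j ∈ Finset.range t, llrStep L X s d l j ω →
          1 - α ≤ posterior P Λ X (uniformStrategy s N) (((l - 1) / s + t) * s) ω := by
        refine ae_all_iff.2 fun t => ?_
        by_cases ht : (l - 1) / s + t ≤ N
        · filter_upwards [h.ae_le_posterior_of_le_sum hf₀ hf₁ hp₀ hp₁ hρ₀ hρ₁ hL hQ hLpos hs hl ht
            hα] with ω hω _
          rw [hd]
          exact hω
        · exact ae_of_all _ fun ω h' => absurd h' ht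
      filter_upwards [h1, h.ae_le_posterior_of_exhausted hp₀ hp₁ hρ₀ hρ₁ hs N hα
        (J := J) (by rwa [← hd])] with ω h2 h3 hω
      exact delay_le_of_staysBelow hc hs
        (fun t ht hct => thresholdRule_le (h2 t ht hω hct)) (thresholdRule_le h3)
    refine (setLIntegral_mono_ae' (h.measurableSet_fiber l) hpath).trans ?_
    have hAind : ∀ k, Measurable ((A k).indicator fun _ => (1 : ℝ≥0∞)) := fun k =>
      measurable_const.indicator (hAm k)
    rw [lintegral_add_right _ ((hAind _).const_mul _),
      lintegral_const_mul _ (Measurable.tsum hAind),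
      lintegral_const_mul _ (hAind _), lintegral_tsum fun k => (hAind k).aemeasurable]
    simp only [lintegral_indicator_const (hAm _), one_mul]
    rw [Measure.restrict_apply (hAm _), hres]
    simp only [Measure.smul_apply, smul_eq_mul, ENNReal.tsum_mul_left]
    rw [mul_left_comm]
    have hsub : A (N - (l - 1) / s) ∩ Λ ⁻¹' {l} ⊆ Λ ⁻¹' {l} ∩
        {ω | ∑ j ∈ Finset.range (n - (l - 1) / s), llrStep L X s d l j ω < c} :=
      fun ω hω => ⟨hω.2, hω.1 _ (Nat.sub_le_sub_right hnN _)⟩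
    exact add_le_add (by gcongr) (mul_le_mul_right (measure_mono hsub) _)
  rw [h.add_eq_tsum]
  refine (ENNReal.tsum_le_tsum hl).trans ?_
  rw [ENNReal.tsum_add, ENNReal.tsum_mul_right, ENNReal.tsum_mul_left, h.tsum_measure_fiber,
    one_mul]
  rfl

/-- For fixed l the strong law applies, since losing (l - 1) / s samples leaves the boundary slope v
unchanged. Dominated convergence, with the prior masses as dominating series, sums over l. -/
lemma IsChangePointModel.tendsto_crossingFailure (h : IsChangePointModel P m f₀ f₁ p ρ Λ X)
    (hf₁ : IsPDF m f₁) {L : E → ℝ≥0∞} (hL : Measurable L) {s : ℕ} (hs : 1 ≤ s) {d : ℝ}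
    (hint : Integrable (fun x => Real.log (L x).toReal) (m.withDensity f₁))
    {ι : Type*} {F : Filter ι} [F.IsCountablyGenerated] {n : ι → ℕ} {c : ι → ℝ} {v : ℝ}
    (hn : Tendsto n F atTop)
    (hc : ∀ q : ℕ, Tendsto (fun i => c i / (n i - q : ℕ)) F (𝓝 v))
    (hv : v < ∫ x, Real.log (L x).toReal ∂(m.withDensity f₁) + d) :
    Tendsto (fun i => crossingFailure P Λ X L s d (n i) (c i)) F (𝓝 0) := by
  have := hf₁.isProbabilityMeasure
  have hint' : Integrable (fun x => Real.log (L x).toReal + d) (m.withDensity f₁) :=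
    hint.add (integrable_const d)
  have hterm : ∀ l : ℕ, Tendsto (fun i => P (Λ ⁻¹' {l} ∩
      {ω | ∑ j ∈ Finset.range (n i - (l - 1) / s), llrStep L X s d l j ω < c i})) F (𝓝 0) := by
    intro l
    by_cases hl : P (Λ ⁻¹' {l}) = 0
    · exact tendsto_const_nhds.congr fun i =>
        (measure_mono_null Set.inter_subset_left hl).symm
    have : IsProbabilityMeasure (ProbabilityTheory.cond P (Λ ⁻¹' {l})) :=
      cond_isProbabilityMeasure hl
    have hmp := h.measurePreserving_data hs hl
    have hmeas := h.measurable_llrStep hL s d l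
    have hφ : Measurable fun x : E => Real.log (L x).toReal + d :=
      hL.ennreal_toReal.log.add_const d
    have hmap : ∀ j, (ProbabilityTheory.cond P (Λ ⁻¹' {l})).map (llrStep L X s d l j)
        = (m.withDensity f₁).map fun x => Real.log (L x).toReal + d := fun j => by
      rw [← (hmp j).map_eq, Measure.map_map hφ (h.measurable_data _)]
      rfl
    have h1 := tendsto_measure_sum_lt (F := F) (n := fun i => n i - (l - 1) / s) (c := c) (v := v)
      hmeas (h.iIndepFun_llrStep hL hs d hl)
      ((hmp 0).integrable_comp_of_integrable hint')
      (fun i => ⟨(hmeas i).aemeasurable, (hmeas 0).aemeasurable, by rw [hmap, hmap]⟩)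
      ((tendsto_sub_atTop_nat _).comp hn) (hc _) (by
        have h2 : ∫ ω, llrStep L X s d l 0 ω ∂(ProbabilityTheory.cond P (Λ ⁻¹' {l}))
            = ∫ x, Real.log (L x).toReal ∂(m.withDensity f₁) + d := by
          rw [← integral_map (f := fun y : ℝ => y) (hmeas 0).aemeasurable
            aestronglyMeasurable_id, hmap,
            integral_map (f := fun y : ℝ => y) hφ.aemeasurable aestronglyMeasurable_id,
            integral_add hint (integrable_const d)]
          simp
        rw [h2]
        exact hv)
    have h3 := ENNReal.Tendsto.const_mul (a := P (Λ ⁻¹' {l})) h1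
      (Or.inr (measure_ne_top P _))
    rw [mul_zero] at h3
    refine h3.congr fun i => ?_
    rw [cond_apply (h.measurableSet_fiber l), ← mul_assoc,
      ENNReal.mul_inv_cancel hl (measure_ne_top P _), one_mul]
  have hsum : Summable fun l : ℕ => P.real (Λ ⁻¹' {l}) :=
    ENNReal.summable_toReal (by rw [h.tsum_measure_fiber]; exact ENNReal.one_ne_top)
  have key := tendsto_tsum_of_dominated_convergence (𝓕 := F)
    (f := fun i l => P.real (Λ ⁻¹' {l} ∩
      {ω | ∑ j ∈ Finset.range (n i - (l - 1) / s), llrStep L X s d l j ω < c i}))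
    (g := fun _ => 0) hsum
    (fun l => (ENNReal.tendsto_toReal ENNReal.zero_ne_top).comp (hterm l))
    (Eventually.of_forall fun i l => by
      rw [Real.norm_of_nonneg measureReal_nonneg]
      exact measureReal_mono Set.inter_subset_left)
  have h4 := ENNReal.tendsto_ofReal key
  rw [tsum_zero, ENNReal.ofReal_zero] at h4
  refine h4.congr fun i => ?_
  rw [ENNReal.ofReal_tsum_of_nonneg (fun _ => measureReal_nonneg)]
  · exact tsum_congr fun l => ofReal_measureReal
  · exact hsum.of_nonneg_of_le (fun _ => measureReal_nonneg)
      fun l => measureReal_mono Set.inter_subset_left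

lemma IsChangePointModel.add_thresholdRule_le_of_eq (h : IsChangePointModel P m f₀ f₁ p ρ Λ X)
    (hf₀ : IsPDF m f₀) (hf₁ : IsPDF m f₁) (hp₀ : 0 ≤ p)
    (hp₁ : p < 1) (hρ₀ : 0 < ρ) (hρ₁ : ρ < 1) (heq : m.withDensity f₁ = m.withDensity f₀)
    {s : ℕ} (N : ℕ) (hs : 1 ≤ s) {α : ℝ} (hα : 0 < α) {t : ℕ}
    (ht : -Real.log α + boundaryShift p ρ s ≤ t * (s * |Real.log (1 - ρ)|)) :
    ADD P Λ (thresholdRule P Λ X s N α) ≤ (t * s : ℕ) := by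
  rw [h.add_eq_tsum]
  have hl : ∀ l : ℕ, ∫⁻ ω in Λ ⁻¹' {l},
      ((thresholdRule P Λ X s N α ω - (l : ℕ∞) : ℕ∞) : ℝ≥0∞) ∂P
      ≤ P (Λ ⁻¹' {l}) * (t * s : ℕ) := by
    intro l
    by_cases hl : P (Λ ⁻¹' {l}) = 0
    · rw [setLIntegral_measure_zero _ _ hl]
      exact zero_le
    have hpath : ∀ᵐ ω ∂P, ω ∈ Λ ⁻¹' {l} →
        ((thresholdRule P Λ X s N α ω - (l : ℕ∞) : ℕ∞) : ℝ≥0∞) ≤ (t * s : ℕ) := by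
      filter_upwards [h.ae_le_posterior_of_eq hf₀ hf₁ hp₀ hp₁ hρ₀ hρ₁ heq N hs hl hα ht] with ω hω _
      obtain ⟨hq1, -⟩ := div_mul_le_self_lt hs l
      have h1 : thresholdRule P Λ X s N α ω - (l : ℕ∞) ≤ ((t * s : ℕ) : ℕ∞) := by
        refine tsub_le_iff_right.2 ((thresholdRule_le hω).trans ?_)
        norm_cast
        rw [add_mul]
        generalize (l - 1) / s = q at *
        omega
      exact_mod_cast ENat.toENNReal_le.2 h1
    refine (setLIntegral_mono_ae' (h.measurableSet_fiber l) hpath).trans (le_of_eq ?_)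
    rw [setLIntegral_const, mul_comm]
  refine (ENNReal.tsum_le_tsum hl).trans ?_
  rw [ENNReal.tsum_mul_right, h.tsum_measure_fiber, one_mul]

end Model

/-! ### Asymptotics as α tends to 0 -/

/-- A family of upper bounds `b (1 + ε)`, valid eventually for each `ε > 0`, can be merged into one
bound `b (1 + o)`. -/
lemma exists_tendsto_zero_of_forall_eventually_le {ι : Type*} {F : Filter ι} {G : ι → ℝ≥0∞}
    {b : ι → ℝ} (hb : ∀ᶠ i in F, 0 < b i)
    (h : ∀ ε : ℝ, 0 < ε → ∀ᶠ i in F, G i ≤ ENNReal.ofReal (b i * (1 + ε))) :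
    ∃ o : ι → ℝ, Tendsto o F (𝓝 0) ∧ ∀ᶠ i in F, G i ≤ ENNReal.ofReal (b i * (1 + o i)) := by
  -- The relative excess of G over b, cut off at 0, serves as o; the hypothesis at ε = 1 ensures
  -- that G is finite.
  refine ⟨fun i => max 0 ((G i).toReal / b i - 1), ?_, ?_⟩
  · rw [Metric.tendsto_nhds]
    intro ε hε
    filter_upwards [hb, h (ε / 2) (half_pos hε)] with i hi hG
    have h1 : (G i).toReal ≤ b i * (1 + ε / 2) :=
      ENNReal.toReal_le_of_le_ofReal (by positivity) hG
    have h2 : (G i).toReal / b i ≤ 1 + ε / 2 := (div_le_iff₀' hi).2 h1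
    rw [Real.dist_eq, sub_zero, abs_of_nonneg (le_max_left _ _)]
    exact max_lt hε (by linarith)
  · filter_upwards [hb, h 1 one_pos] with i hi hG
    have hfin : G i ≠ ∞ := ne_top_of_le_ne_top ENNReal.ofReal_ne_top hG
    rw [← ENNReal.ofReal_toReal hfin]
    refine ENNReal.ofReal_le_ofReal ?_
    rw [ENNReal.toReal_ofReal ENNReal.toReal_nonneg]
    calc (G i).toReal = b i * (1 + ((G i).toReal / b i - 1)) := by field_simp; ring
      _ ≤ _ := by gcongr; exact le_max_right _ _

lemma tendsto_linear_div_ceil_sub (d C : ℝ) (q : ℕ) :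
    Tendsto (fun x : ℝ => (d * x + C) / (⌈x⌉₊ - q : ℕ)) atTop (𝓝 d) := by
  have h1 : Tendsto (fun x : ℝ => (d + C * x⁻¹) / (⌈x⌉₊ / x - q * x⁻¹)) atTop
      (𝓝 ((d + C * 0) / (1 - q * 0))) :=
    (tendsto_const_nhds.add (tendsto_inv_atTop_zero.const_mul C)).div
      (tendsto_nat_ceil_div_atTop.sub (tendsto_inv_atTop_zero.const_mul (q : ℝ)))
      (by norm_num)
  simp only [mul_zero, add_zero, sub_zero, div_one] at h1
  refine h1.congr' ?_
  filter_upwards [eventually_gt_atTop (0 : ℝ), eventually_ge_atTop (q : ℝ)] with x hx hq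
  have hq' : q ≤ ⌈x⌉₊ := by exact_mod_cast hq.trans (Nat.le_ceil x)
  rw [Nat.cast_sub hq', ← div_eq_mul_inv, ← div_eq_mul_inv, ← sub_div]
  rw [← div_div_div_cancel_right₀ hx.ne' (d * x + C)]
  congr 1
  field_simp

lemma tendsto_neg_log_nhdsGT_zero : Tendsto (fun α : ℝ => -Real.log α) (𝓝[>] 0) atTop :=
  tendsto_neg_atBot_atTop.comp Real.tendsto_log_nhdsGT_zero

section Model

variable {Ω E : Type*} [MeasurableSpace Ω] [MeasurableSpace E] {P : Measure Ω}
  [IsProbabilityMeasure P] {m : Measure E} {f₀ f₁ : E → ℝ≥0∞} {p ρ : ℝ} {Λ : Ω → ℕ}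
  {X : ℕ → Ω → E}

lemma IsChangePointModel.eventually_add_thresholdRule_le_of_eq
    (h : IsChangePointModel P m f₀ f₁ p ρ Λ X)
    (hf₀ : IsPDF m f₀) (hf₁ : IsPDF m f₁) (hp₀ : 0 ≤ p) (hp₁ : p < 1) (hρ₀ : 0 < ρ) (hρ₁ : ρ < 1)
    (heq : m.withDensity f₁ = m.withDensity f₀) {s : ℕ} (hs : 1 ≤ s) {ε : ℝ} (hε : 0 < ε) :
    ∀ᶠ α in 𝓝[>] (0 : ℝ), ∀ N : ℕ, ADD P Λ (thresholdRule P Λ X s N α)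
      ≤ ENNReal.ofReal (s * -Real.log α / (s * |Real.log (1 - ρ)|) * (1 + ε)) := by
  have hs' : (0 : ℝ) < s := by exact_mod_cast hs
  have hb : 0 < |Real.log (1 - ρ)| :=
    abs_pos.2 (Real.log_neg (by linarith) (by linarith)).ne
  set d := s * |Real.log (1 - ρ)| with hd
  have hd0 : 0 < d := mul_pos hs' hb
  set C := boundaryShift p ρ s
  have hC : 0 ≤ C := boundaryShift_nonneg hp₀ hp₁ hρ₀ hρ₁ s
  filter_upwards [self_mem_nhdsWithin,
    tendsto_neg_log_nhdsGT_zero.eventually_ge_atTop ((C + d) / ε),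
    tendsto_neg_log_nhdsGT_zero.eventually_ge_atTop 0] with α hα h1 h2 N
  rw [div_le_iff₀ hε] at h1
  have ht : -Real.log α + C ≤ ⌈(-Real.log α + C) / d⌉₊ * d :=
    (div_le_iff₀ hd0).1 (Nat.le_ceil _)
  refine (h.add_thresholdRule_le_of_eq hf₀ hf₁ hp₀ hp₁ hρ₀ hρ₁ heq N hs hα ht).trans ?_
  rw [← ENNReal.ofReal_natCast]
  refine ENNReal.ofReal_le_ofReal ?_
  have h3 := (Nat.ceil_lt_add_one (a := (-Real.log α + C) / d) (by positivity)).le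
  push_cast
  calc (⌈(-Real.log α + C) / d⌉₊ : ℝ) * s ≤ ((-Real.log α + C) / d + 1) * s := by gcongr
    _ = s * (-Real.log α + (C + d)) / d := by field_simp; ring
    _ ≤ s * (-Real.log α + -Real.log α * ε) / d := by gcongr
    _ = _ := by ring

lemma IsChangePointModel.eventually_add_thresholdRule_le_of_pos
    (h : IsChangePointModel P m f₀ f₁ p ρ Λ X)
    (hf₀ : IsPDF m f₀) (hf₁ : IsPDF m f₁) (hp₀ : 0 ≤ p) (hp₁ : p < 1) (hρ₀ : 0 < ρ) (hρ₁ : ρ < 1)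
    {L : E → ℝ≥0∞} (hL : Measurable L)
    (hQ : (m.withDensity f₀).withDensity L = m.withDensity f₁)
    (hLpos : ∀ᵐ x ∂(m.withDensity f₁), 0 < L x ∧ L x < ∞)
    (hint : Integrable (fun x => Real.log (L x).toReal) (m.withDensity f₁)) {D : ℝ}
    (hD : ∫ x, Real.log (L x).toReal ∂(m.withDensity f₁) = D) (hD0 : 0 < D)
    {s : ℕ} (hs : 1 ≤ s) {ε : ℝ} (hε : 0 < ε) :
    ∀ᶠ α in 𝓝[>] (0 : ℝ), ∀ N : ℕ, -Real.log α / (s * |Real.log (1 - ρ)|) ≤ N →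
      ADD P Λ (thresholdRule P Λ X s N α)
        ≤ ENNReal.ofReal (s * -Real.log α / (D + s * |Real.log (1 - ρ)|) * (1 + ε)) := by
  have := hf₁.isProbabilityMeasure
  have hs' : (0 : ℝ) < s := by exact_mod_cast hs
  have hb : 0 < |Real.log (1 - ρ)| :=
    abs_pos.2 (Real.log_neg (by linarith) (by linarith)).ne
  obtain ⟨d, hd⟩ : ∃ d, d = s * |Real.log (1 - ρ)| := ⟨_, rfl⟩
  rw [← hd]
  have hd0 : 0 < d := hd ▸ mul_pos hs' hb
  set C := boundaryShift p ρ s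
  have hC : 0 ≤ C := boundaryShift_nonneg hp₀ hp₁ hρ₀ hρ₁ s
  have hv0 : 0 < D + d := by positivity
  -- A truncation level M, fixed before α, loses at most a factor 1 + ε/2 in the passage time.
  obtain ⟨M, r, hr, hmean, hrv⟩ : ∃ (M : ℕ) (r : ℝ), 0 < r ∧
      ∫ x, min (Real.log (L x).toReal + d) M ∂(m.withDensity f₁) = r ∧
      1 / r ≤ 1 / (D + d) * (1 + ε / 2) := by
    have h1 := tendsto_integral_min (Y := fun x => Real.log (L x).toReal + d)
      (hint.add (integrable_const d))
    have h2 : ∫ x, (Real.log (L x).toReal + d) ∂(m.withDensity f₁) = D + d := by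
      rw [integral_add hint (integrable_const d), hD]
      simp
    rw [h2] at h1
    have h3 : (D + d) / (1 + ε / 2) < D + d := div_lt_self hv0 (by linarith)
    obtain ⟨M, hM⟩ := (h1.eventually (lt_mem_nhds h3)).exists
    have hpos : 0 < (D + d) / (1 + ε / 2) := by positivity
    refine ⟨M, _, hpos.trans hM, rfl, ?_⟩
    calc _ ≤ 1 / ((D + d) / (1 + ε / 2)) := one_div_le_one_div_of_le hpos hM.le
      _ = _ := by rw [one_div_div, one_div_mul_eq_div]
  have hx : Tendsto (fun α : ℝ => -Real.log α / d) (𝓝[>] 0) atTop :=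
    tendsto_neg_log_nhdsGT_zero.atTop_div_const hd0
  have hfail := h.tendsto_crossingFailure hf₁ hL hs (d := d) hint (F := 𝓝[>] (0 : ℝ))
    (n := fun α => ⌈-Real.log α / d⌉₊) (c := fun α => -Real.log α + C) (v := d)
    (tendsto_nat_ceil_atTop.comp hx)
    (fun q => ((tendsto_linear_div_ceil_sub d C q).comp hx).congr fun α => by
      simp only [Function.comp]
      rw [mul_div_cancel₀ _ hd0.ne'])
    (by rw [hD]; linarith)
  -- The remaining ε/2 is split evenly: one quarter of ε pays for failed crossings, costing a δ / d
  -- periods to leading order, and one for the constant terms.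
  have hδ : 0 < ε * d / (4 * (D + d)) := by positivity
  set δ := ε * d / (4 * (D + d)) with hδdef
  filter_upwards [self_mem_nhdsWithin,
    tendsto_neg_log_nhdsGT_zero.eventually_ge_atTop
      (((C + M) / r + δ) / (ε / (4 * (D + d)))),
    tendsto_neg_log_nhdsGT_zero.eventually_gt_atTop 0,
    hfail.eventually_le_const (ENNReal.ofReal_pos.2 hδ)] with α hα h1 h2 h3 N hN
  have hα0 : 0 < α := hα
  have hα1 : α < 1 := by
    by_contra hcon
    linarith [Real.log_nonneg (not_lt.1 hcon)]
  -- The same ⌈a / d⌉ serves as n, the samples guaranteed by the hypothesis on N, and as J, the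
  -- periods after which the prior alone suffices.
  refine (h.add_thresholdRule_le hf₀ hf₁ hp₀ hp₁ hρ₀ hρ₁ hL hQ hLpos hs hd hint
    (Nat.cast_nonneg M) hr hmean hα0 hα1 (n := ⌈-Real.log α / d⌉₊) (J := ⌈-Real.log α / d⌉₊)
    (Nat.ceil_le.2 hN) ((div_le_iff₀ hd0).1 (Nat.le_ceil _))).trans ?_
  refine (add_le_add le_rfl (mul_le_mul_right h3 _)).trans ?_
  rw [← ENNReal.ofReal_natCast, ← ENNReal.ofReal_natCast, ← ENNReal.ofReal_mul (by positivity),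
    ← ENNReal.ofReal_mul (by positivity), ← ENNReal.ofReal_add (by positivity) (by positivity)]
  refine ENNReal.ofReal_le_ofReal ?_
  have h4 := (Nat.ceil_lt_add_one (a := -Real.log α / d) (by positivity)).le
  rw [div_le_iff₀ (by positivity)] at h1
  generalize -Real.log α = a at *
  push_cast
  calc (s : ℝ) * ((a + C + M) / r) + ⌈a / d⌉₊ * s * δ
      ≤ s * ((a + C + M) / r) + (a / d + 1) * s * δ := by gcongr
    _ = s * (a * (1 / r) + a * (δ / d) + ((C + M) / r + δ)) := by ring
    _ ≤ s * (a * (1 / (D + d) * (1 + ε / 2)) + a * (δ / d) + a * (ε / (4 * (D + d)))) := by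
        gcongr
    _ = _ := by
        rw [hδdef]
        field_simp
        ring

end Model

end QuickestDetection

/-! ### The main theorem -/

open QuickestDetection
theorem proposition2 {Ω E : Type*} [MeasurableSpace Ω] [MeasurableSpace E]
    (P : Measure Ω) [IsProbabilityMeasure P] (m : Measure E) (f₀ f₁ : E → ℝ≥0∞)
    (hf₀ : IsPDF m f₀) (hf₁ : IsPDF m f₁)
    (p ρ : ℝ) (hp₀ : 0 ≤ p) (hp₁ : p < 1) (hρ₀ : 0 < ρ) (hρ₁ : ρ < 1)
    (Λ : Ω → ℕ) (X : ℕ → Ω → E) (hmodel : IsChangePointModel P m f₀ f₁ p ρ Λ X)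
    (hD : divergence m f₁ f₀ ≠ ∞) (s : ℕ) (hs : 1 ≤ s) :
    ∃ o : ℝ → ℝ, Tendsto o (𝓝[>] 0) (𝓝 0) ∧
      ∀ᶠ α in 𝓝[>] (0 : ℝ), ∀ N : ℕ,
        |Real.log α| / (|Real.log (1 - ρ)| * s) ≤ N →
          optimalADD P Λ X N α ≤
              ENNReal.ofReal (s * |Real.log α| /
                ((divergence m f₁ f₀).toReal + s * |Real.log (1 - ρ)|) * (1 + o α)) ∧
          (IsSamplingStrategy X N (uniformStrategy s N) ∧
            IsStopTime (obsSigma X (uniformStrategy s N)) (thresholdRule P Λ X s N α) ∧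
            PFA P Λ (thresholdRule P Λ X s N α) ≤ ENNReal.ofReal α ∧
            ADD P Λ (thresholdRule P Λ X s N α) ≤
              ENNReal.ofReal (s * |Real.log α| /
                ((divergence m f₁ f₀).toReal + s * |Real.log (1 - ρ)|) * (1 + o α))) := by
  have := hf₀.isProbabilityMeasure
  have := hf₁.isProbabilityMeasure
  have hs' : (0 : ℝ) < s := by exact_mod_cast hs
  have hb : 0 < |Real.log (1 - ρ)| :=
    abs_pos.2 (Real.log_neg (by linarith) (by linarith)).ne
  have habs : ∀ᶠ α in 𝓝[>] (0 : ℝ), 0 < |Real.log α| ∧ |Real.log α| = -Real.log α := by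
    filter_upwards [tendsto_neg_log_nhdsGT_zero.eventually_gt_atTop 0] with α hα
    have h1 : |Real.log α| = -Real.log α := abs_of_neg (by linarith)
    exact ⟨h1 ▸ hα, h1⟩
  obtain ⟨o, ho, hle⟩ := exists_tendsto_zero_of_forall_eventually_le (F := 𝓝[>] (0 : ℝ))
    -- The supremum over all admissible N makes one function o serve for every N.
    (G := fun α => ⨆ (N : ℕ) (_ : |Real.log α| / (|Real.log (1 - ρ)| * s) ≤ N),
      ADD P Λ (thresholdRule P Λ X s N α))
    (b := fun α => s * |Real.log α| /
      ((divergence m f₁ f₀).toReal + s * |Real.log (1 - ρ)|))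
    (habs.mono fun α hα => div_pos (mul_pos hs' hα.1)
      (add_pos_of_nonneg_of_pos ENNReal.toReal_nonneg (mul_pos hs' hb)))
    (fun ε hε => by
      obtain ⟨hac, hint⟩ := klDiv_ne_top_iff.1 hD
      -- For D = 0 the walk's drift equals the boundary slope d and the strong law gives no margin,
      -- so this case is separate.
      by_cases h0 : divergence m f₁ f₀ = 0
      · rw [h0, ENNReal.toReal_zero, zero_add]
        filter_upwards [habs, hmodel.eventually_add_thresholdRule_le_of_eq hf₀ hf₁ hp₀ hp₁ hρ₀ hρ₁
          (klDiv_eq_zero_iff.1 h0) hs hε] with α h1 h2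
        rw [h1.2]
        exact iSup₂_le fun N _ => h2 N
      · have hpos : ∀ᵐ x ∂(m.withDensity f₁),
            0 < (m.withDensity f₁).rnDeriv (m.withDensity f₀) x ∧
              (m.withDensity f₁).rnDeriv (m.withDensity f₀) x < ∞ :=
          (Measure.rnDeriv_pos hac).and (hac.ae_le (Measure.rnDeriv_lt_top _ _))
        filter_upwards [habs, hmodel.eventually_add_thresholdRule_le_of_pos hf₀ hf₁ hp₀ hp₁ hρ₀ hρ₁
          (Measure.measurable_rnDeriv _ _) (Measure.withDensity_rnDeriv_eq _ _ hac) hpos hint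
          (toReal_klDiv_of_measure_eq hac (by simp)).symm (ENNReal.toReal_pos h0 hD) hs hε]
          with α h1 h2
        rw [h1.2, mul_comm |Real.log (1 - ρ)|]
        exact iSup₂_le h2)
  refine ⟨o, ho, ?_⟩
  filter_upwards [hle, self_mem_nhdsWithin] with α h1 (hα : 0 < α) N hN
  have hsampling := isSamplingStrategy_uniformStrategy X hs N
  have htime := isStopTime_thresholdRule P Λ X s N α
  have hpfa := pfa_thresholdRule_le (P := P) (s := s) (N := N) hmodel.measurable_changePoint
    hmodel.measurable_data hα.le
  have hadd := (le_iSup₂_of_le (f := fun (N : ℕ)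
    (_ : |Real.log α| / (|Real.log (1 - ρ)| * s) ≤ N) =>
      ADD P Λ (thresholdRule P Λ X s N α)) N hN le_rfl).trans h1
  refine ⟨le_trans ?_ hadd, hsampling, htime, hpfa, hadd⟩
  exact iInf_le_of_le (uniformStrategy s N) <| iInf_le_of_le (thresholdRule P Λ X s N α) <|
    iInf_le_of_le hsampling <| iInf_le_of_le (fun k => le_sup_left (a := obsSigma X _ k) _ (htime k)) <|
    iInf_le_of_le hpfa le_rfl
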